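/- Let $X=(X_t)_{t\ge 0}$ be a L\'evy process with values in $\mathbb{R}^n$ (that is, $X_0=0$ a.s., $X$ has independent and stationary increments, and almost all paths are right-continuous with finite left-hand limits), let $\mu_t$ be the law of $X_t$, and let $\psi:\mathbb{R}^n\to\mathbb{C}$ be its characteristic exponent, i.e. $\mathbb{E}\,e^{i\xi\cdot X_t}=e^{-t\psi(\xi)}$ for all $t\ge 0$, $\xi\in\mathbb{R}^n$. Denote by $\mathcal{L}_\psi$ the generator of $X$, i.e. the pseudo-differential operator $$\mathcal{L}_\psi u(x)=-\int_{\mathbb{R}^n}e^{ix\cdot\xi}\,\psi(\xi)\,\widehat u(\xi)\,d\xi,\qquad \widehat u(\xi)=(2\pi)^{-n}\int_{\mathbb{R}^n}e^{-ix\cdot\xi}u(x)\,dx,$$ for $u$ in the Schwartz space $\mathcal{S}(\mathbb{R}^n)$, and for $f\in L^\infty(\mathbb{R}^n)$ let $\mathcal{L}_\psi f$ be the distribution $\langle\mathcal{L}_\psi f,\phi\rangle:=\int_{\mathbb{R}^n}f(x)\,\mathcal{L}_{\overline\psi}\,\phi(x)\,dx$, $\phi\in C_c^\infty(\mathbb{R}^n)$.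 Suppose that for at least one $t_0>0$ the measure $\mu_{t_0}$ has an everywhere strictly positive density, i.e. $\mu_{t_0}(dx)=p_{t_0}(x)\,dx$ with $p_{t_0}(x)>0$ for all $x\in\mathbb{R}^n$. Then $\mathcal{L}_\psi$ has the Liouville property: if $f\in L^\infty(\mathbb{R}^n)$ (complex-valued) satisfies $\langle\mathcal{L}_\psi f,\phi\rangle=0$ for all $\phi\in C_c^\infty(\mathbb{R}^n)$, then $f$ is constant Lebesgue-almost everywhere. -/

import Mathlib

open MeasureTheory ProbabilityTheory Filter Topology FourierTransform SchwartzMap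
open scoped NNReal ENNReal

/-- A Lévy process with values in `ℝⁿ`: it starts at `0`, has independent and stationary
increments, and almost all paths are right-continuous with finite left-hand limits. -/
structure IsLevyProcess {n : ℕ} {Ω : Type*} [MeasurableSpace Ω]
    (X : ℝ≥0 → Ω → EuclideanSpace ℝ (Fin n)) (P : Measure Ω) : Prop where
  measurable : ∀ t, Measurable (X t)
  start_zero : ∀ᵐ ω ∂P, X 0 ω = 0
  indep_increments : HasIndepIncrements X P
  stationary_increments : ∀ s t : ℝ≥0,
    P.map (fun ω => X (s + t) ω - X s ω) = P.map (X t)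
  cadlag : ∀ᵐ ω ∂P, ∀ t : ℝ≥0,
    ContinuousWithinAt (fun s => X s ω) (Set.Ici t) t ∧
      ∃ l, Tendsto (fun s => X s ω) (𝓝[<] t) (𝓝 l)

/-- The transition probability `μ_t` of a Lévy process, the law of `X_t`. -/
noncomputable def transitionLaw {n : ℕ} {Ω : Type*} [MeasurableSpace Ω]
    (X : ℝ≥0 → Ω → EuclideanSpace ℝ (Fin n)) (P : Measure Ω) (t : ℝ≥0) :
    Measure (EuclideanSpace ℝ (Fin n)) :=
  P.map (X t)

/-- `ψ` is the characteristic exponent of the process `X`: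
`𝔼 exp (i ξ · X_t) = exp (-t ψ(ξ))` for all `t ≥ 0` and `ξ ∈ ℝⁿ`. -/
def HasCharExponent {n : ℕ} {Ω : Type*} [MeasurableSpace Ω]
    (X : ℝ≥0 → Ω → EuclideanSpace ℝ (Fin n)) (P : Measure Ω)
    (ψ : EuclideanSpace ℝ (Fin n) → ℂ) : Prop :=
  ∀ (t : ℝ≥0) (ξ : EuclideanSpace ℝ (Fin n)),
    charFun (transitionLaw X P t) ξ = Complex.exp (-((t : ℝ) : ℂ) * ψ ξ)

/-- The pseudo-differential operator `L_ψ` with symbol `-ψ`, acting on Schwartz functions: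
`L_ψ u (x) = -∫ exp (i x · η) ψ(η) û(η) dη` with `û(η) = (2π)⁻ⁿ ∫ exp (-i y · η) u(y) dy`.
Mathlib's Fourier transform `𝓕` has the kernel `exp (-2 π i y · ξ)`; the substitution `η = 2 π ξ`
turns the formula above into the one below. -/
noncomputable def levyGenerator {n : ℕ} (ψ : EuclideanSpace ℝ (Fin n) → ℂ)
    (u : 𝓢(EuclideanSpace ℝ (Fin n), ℂ)) : EuclideanSpace ℝ (Fin n) → ℂ :=
  𝓕⁻ (fun ξ : EuclideanSpace ℝ (Fin n) =>
    -ψ ((2 * Real.pi) • ξ) * 𝓕 (u : EuclideanSpace ℝ (Fin n) → ℂ) ξ)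

/-- The distribution `L_ψ f`, for `f ∈ L^∞(ℝⁿ)`, evaluated at a test function `φ`:
`⟨L_ψ f, φ⟩ = ∫ f(x) (L_ψ^* φ)(x) dx`, where the adjoint `L_ψ^*` is the operator whose symbol is
the complex conjugate of `ψ`. -/
noncomputable def levyGeneratorPairing {n : ℕ} (ψ : EuclideanSpace ℝ (Fin n) → ℂ)
    (f : EuclideanSpace ℝ (Fin n) → ℂ) (φ : 𝓢(EuclideanSpace ℝ (Fin n), ℂ)) : ℂ :=
  ∫ x, f x * levyGenerator (fun ξ => (starRingEnd ℂ) (ψ ξ)) φ x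

/-- The Liouville property of `L_ψ`: every `f ∈ L^∞(ℝⁿ)` with `⟨L_ψ f, φ⟩ = 0` for all
`φ ∈ C_c^∞(ℝⁿ)` is (almost everywhere) constant. -/
def HasLiouvilleProperty {n : ℕ} (ψ : EuclideanSpace ℝ (Fin n) → ℂ) : Prop :=
  ∀ f : EuclideanSpace ℝ (Fin n) → ℂ, MemLp f ∞ volume →
    (∀ φ : 𝓢(EuclideanSpace ℝ (Fin n), ℂ), HasCompactSupport φ →
      levyGeneratorPairing ψ f φ = 0) →
    ∃ c : ℂ, f =ᵐ[volume] fun _ => c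

/-!
A bounded weak solution `f` of `L_ψ f = 0` is invariant under the semigroup of the process,
`f x = ∫ f (x + y) dμ_t(y)` for almost every `x`, and when `μ_t` has a strictly positive density the
only bounded functions with this invariance are the constants.

Let `T_t φ x = ∫ φ (x - y) dμ_t(y)` be the adjoint semigroup, with generator `L = L_ψ̄`. For a test
function `φ` one has `T_t φ - φ = ∫₀ᵗ T_s L φ ds`. Since `L` commutes with translations, `T_s L φ` is
an average of functions `L (φ (· - y))`, and every translate `φ (· - y)` is again a compactly supported
test function. Hence `f` is orthogonal to `T_s L φ` for all `s`, and so to `T_t φ - φ`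
(`integral_mul_semigroup_sub_eq_zero`). No extension of the equation to test functions without
compact support is needed.

The interchanges of integrals require that `L φ` is integrable (`integrable_levyGenerator_conj`). This
is obtained without the Lévy-Khintchine formula. The exponent grows at most quadratically
(`exists_norm_exponent_le`), so the difference quotients `(T_t φ - φ) / t` converge pointwise to `L φ`.
They are bounded in `L¹` (`exists_lintegral_semigroup_sub_le`): by Taylor's formula it suffices that
`∫ min 1 (‖y‖ ^ 2) dμ_t` and `∫ sin y_j dμ_t` are `O(t)`, and both are controlled by
`‖1 - charFun μ_t ξ‖ ≤ t ‖ψ ξ‖`, the former after averaging over a Gaussian `ξ`. Fatou's lemma then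
gives `L φ ∈ L¹`.

The last step is a Choquet-Deny theorem (`ae_const_of_ae_harmonic`). If `g` is bounded and harmonic
for the positive density `p`, then so is each increment `g (· + a) - g`. At a point where an increment
is close to its supremum, positivity of `p` forces it to be close to the supremum at any prescribed
finite number of translates of the point as well (`exists_harnack`). Adding up increments along
`x, x + a, …, x + (m - 1) a` would make `g` unbounded if the supremum were positive.
-/

/-! ### The Choquet-Deny theorem for strictly positive densities -/

section ChoquetDeny

variable {E : Type*} [NormedAddCommGroup E] [InnerProductSpace ℝ E] [FiniteDimensional ℝ E]
  [MeasurableSpace E] [BorelSpace E]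

/-- Translates of a positive density are uniformly absolutely continuous with respect to the density
itself. Since `p > 0`, the excess `(p (· - b) - N p)⁺` tends to `0` in `L¹` as `N → ∞`, so
`p (· - b)` is at most a multiple of `p` up to an error that is small in `L¹`. -/
lemma exists_integral_mul_translate_le {p : E → ℝ} (hp : ∀ x, 0 < p x) (hpi : Integrable p)
    (b : E) {ε : ℝ} (hε : 0 < ε) (K : ℝ) :
    ∃ C : ℝ, 0 ≤ C ∧ ∀ w : E → ℝ, Measurable w → (∀ x, 0 ≤ w x) → (∀ x, w x ≤ K) →
      ∫ y, w y * p (y - b) ≤ C * (∫ y, w y * p y) + ε := by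
  have hpb : Integrable (fun y => p (y - b)) := hpi.comp_sub_right b
  have hlim : Tendsto (fun N : ℕ => ∫ y, max (p (y - b) - N * p y) 0) atTop
      (𝓝 (∫ _ : E, (0 : ℝ))) := by
    refine tendsto_integral_of_dominated_convergence (fun y => p (y - b)) ?_ hpb ?_ ?_
    · intro N
      exact ((hpb.sub (hpi.const_mul (N : ℝ))).pos_part).aestronglyMeasurable
    · intro N
      refine ae_of_all _ fun y => ?_
      rw [Real.norm_of_nonneg (le_max_right _ _)]
      exact max_le (by have := hp y; nlinarith [mul_nonneg (Nat.cast_nonneg N : (0 : ℝ) ≤ N) this.le]) (hp _).le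
    · refine ae_of_all _ fun y => tendsto_const_nhds.congr' ?_
      obtain ⟨N₀, hN₀⟩ := exists_nat_ge (p (y - b) / p y)
      filter_upwards [eventually_ge_atTop N₀] with N hN
      have h1 : p (y - b) / p y ≤ N := hN₀.trans (by exact_mod_cast hN)
      rw [div_le_iff₀ (hp y)] at h1
      exact (max_eq_right (by linarith)).symm
  rw [integral_zero] at hlim
  have hK : 0 < ε / (|K| + 1) := by positivity
  obtain ⟨N, hN⟩ := (hlim.eventually (gt_mem_nhds hK)).exists
  refine ⟨N, Nat.cast_nonneg N, fun w hw hw0 hwK => ?_⟩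
  have hbd : ∀ x, ‖w x‖ ≤ |K| + 1 := fun x => by
    rw [Real.norm_of_nonneg (hw0 x)]
    exact (hwK x).trans ((le_abs_self K).trans (by linarith))
  have hi1 : Integrable (fun y => w y * p y) :=
    hpi.bdd_mul hw.aestronglyMeasurable (ae_of_all _ hbd)
  have hi2 : Integrable (fun y => w y * p (y - b)) :=
    hpb.bdd_mul hw.aestronglyMeasurable (ae_of_all _ hbd)
  have hi3 : Integrable (fun y => max (p (y - b) - N * p y) 0) :=
    (hpb.sub (hpi.const_mul (N : ℝ))).pos_part
  calc ∫ y, w y * p (y - b)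
      ≤ ∫ y, ((N : ℝ) * (w y * p y) + (|K| + 1) * max (p (y - b) - N * p y) 0) := by
        refine integral_mono hi2 ((hi1.const_mul _).add (hi3.const_mul _)) fun y => ?_
        have h1 : w y * (p (y - b) - N * p y) ≤ w y * max (p (y - b) - N * p y) 0 :=
          mul_le_mul_of_nonneg_left (le_max_left _ _) (hw0 y)
        have h2 : w y * max (p (y - b) - N * p y) 0 ≤ (|K| + 1) * max (p (y - b) - N * p y) 0 :=
          mul_le_mul_of_nonneg_right ((le_abs_self _).trans (hbd y)) (le_max_right _ _)
        simp only
        linarith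
    _ = N * (∫ y, w y * p y) + (|K| + 1) * ∫ y, max (p (y - b) - N * p y) 0 := by
        rw [integral_add (hi1.const_mul _) (hi3.const_mul _), integral_const_mul,
          integral_const_mul]
    _ ≤ N * (∫ y, w y * p y) + ε := by
        rw [lt_div_iff₀ (by positivity)] at hN
        linarith

/-- A Harnack inequality with a small additive error for bounded nonnegative `p`-harmonic functions.
The constant depends on the translation `b` and on the bound `K`, but not on `w` or on the point. -/
lemma exists_harnack {p : E → ℝ} (hp : ∀ x, 0 < p x) (hpi : Integrable p)
    (b : E) {ε : ℝ} (hε : 0 < ε) (K : ℝ) :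
    ∃ C : ℝ, 0 ≤ C ∧ ∀ w : E → ℝ, Measurable w → (∀ x, 0 ≤ w x) → (∀ x, w x ≤ K) →
      (∀ x, w x = ∫ y, w (x + y) * p y) → ∀ x, w (x + b) ≤ C * w x + ε := by
  obtain ⟨C, hC, h⟩ := exists_integral_mul_translate_le hp hpi b hε K
  refine ⟨C, hC, fun w hw hw0 hwK hwp x => ?_⟩
  have h1 := h (fun y => w (x + y)) (hw.comp (measurable_const_add x)) (fun _ => hw0 _)
    (fun _ => hwK _)
  rw [← hwp x] at h1
  refine le_trans (le_of_eq ?_) h1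
  rw [hwp (x + b), ← integral_sub_right_eq_self (fun y => w (x + b + y) * p y) b]
  congr 1 with y
  congr 2
  abel

/-- If the increment `h x = g (x + a) - g x` had a supremum `s > 0`, then the Harnack inequality for
`s - h` would give points `x` such that `h` is at least `s / 2` at all of `x, x + a, …,
x + (m - 1) a`, and summing these increments contradicts the boundedness of `g`. -/
lemma harmonic_add_le {p : E → ℝ} (hp : ∀ x, 0 < p x) (hpi : Integrable p)
    (hp1 : ∫ x, p x = 1) {g : E → ℝ} (hg : Measurable g) {M : ℝ} (hM : ∀ x, |g x| ≤ M)
    (hgp : ∀ x, g x = ∫ y, g (x + y) * p y) (a x₀ : E) : g (x₀ + a) ≤ g x₀ := by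
  set h : E → ℝ := fun x => g (x + a) - g x with hh
  have hbdd : BddAbove (Set.range h) := by
    refine ⟨2 * M, ?_⟩
    rintro _ ⟨x, rfl⟩
    have h1 := abs_le.1 (hM (x + a))
    have h2 := abs_le.1 (hM x)
    simp only [hh]
    linarith
  set s := ⨆ x, h x with hs
  have hle : ∀ x, h x ≤ s := fun x => le_ciSup hbdd x
  by_contra! hcon
  have hspos : 0 < s := lt_of_lt_of_le (by simp only [hh]; linarith) (hle x₀)
  have hgi : ∀ x, Integrable (fun y => g (x + y) * p y) := fun x =>
    hpi.bdd_mul (hg.comp (measurable_const_add x)).aestronglyMeasurable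
      (ae_of_all _ fun y => hM (x + y))
  set w : E → ℝ := fun x => s - h x with hw
  have hwm : Measurable w := by
    simp only [hw, hh]
    exact measurable_const.sub ((hg.comp (measurable_add_const a)).sub hg)
  have hw0 : ∀ x, 0 ≤ w x := fun x => sub_nonneg.2 (hle x)
  have hwK : ∀ x, w x ≤ s + 2 * M := fun x => by
    have h1 := abs_le.1 (hM (x + a))
    have h2 := abs_le.1 (hM x)
    simp only [hw, hh]
    linarith
  have hwp : ∀ x, w x = ∫ y, w (x + y) * p y := by
    intro x
    have e : (fun y => w (x + y) * p y) =
        fun y => s * p y - (g (x + a + y) * p y - g (x + y) * p y) := by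
      funext y
      simp only [hw, hh, add_right_comm x y a]
      ring
    have i1 : Integrable (fun y => g (x + a + y) * p y - g (x + y) * p y) :=
      (hgi (x + a)).sub (hgi x)
    rw [e, integral_sub (hpi.const_mul s) i1, integral_sub (hgi (x + a)) (hgi x), integral_const_mul, hp1, ← hgp, ← hgp]
    simp [hw, hh]
  -- `m` increments of size at least `s / 2` exceed the oscillation `2 * M` of `g`.
  obtain ⟨m, hm⟩ := exists_nat_gt (4 * M / s)
  choose C hC0 hC using fun j : ℕ =>
    exists_harnack hp hpi (j • a) (show 0 < s / 4 by positivity) (s + 2 * M)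
  have hden : 0 < 4 * (1 + ∑ j ∈ Finset.range m, C j) := by
    have : 0 ≤ ∑ j ∈ Finset.range m, C j := Finset.sum_nonneg fun j _ => hC0 j
    positivity
  obtain ⟨x, hx⟩ := exists_lt_of_lt_ciSup
    (show s - s / (4 * (1 + ∑ j ∈ Finset.range m, C j)) < ⨆ x, h x from
      sub_lt_self _ (by positivity))
  have hwx : w x < s / (4 * (1 + ∑ j ∈ Finset.range m, C j)) := by
    simp only [hw]; linarith
  have hj : ∀ j ∈ Finset.range m, s / 2 ≤ h (x + j • a) := by
    intro j hjm
    have h1 := hC j w hwm hw0 hwK hwp x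
    have h2 : C j ≤ ∑ j ∈ Finset.range m, C j :=
      Finset.single_le_sum (fun i _ => hC0 i) hjm
    rw [lt_div_iff₀ hden] at hwx
    have h3 : C j * w x ≤ s / 4 := by nlinarith [hw0 x]
    have h4 : w (x + j • a) = s - h (x + j • a) := rfl
    linarith
  have htel : ∑ j ∈ Finset.range m, h (x + j • a) = g (x + m • a) - g x := by
    have := Finset.sum_range_sub (fun j : ℕ => g (x + j • a)) m
    simp only [zero_smul, add_zero] at this
    rw [← this]
    refine Finset.sum_congr rfl fun j _ => ?_
    simp only [hh, succ_nsmul, add_assoc]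
  have h5 : (m : ℝ) * (s / 2) ≤ g (x + m • a) - g x := by
    rw [← htel]
    simpa using Finset.card_nsmul_le_sum _ _ _ hj
  rw [div_lt_iff₀ hspos] at hm
  have h1 := abs_le.1 (hM (x + m • a))
  have h2 := abs_le.1 (hM x)
  linarith

lemma harmonic_eq_apply_zero {p : E → ℝ} (hp : ∀ x, 0 < p x) (hpi : Integrable p)
    (hp1 : ∫ x, p x = 1) {g : E → ℝ} (hg : Measurable g) {M : ℝ} (hM : ∀ x, |g x| ≤ M)
    (hgp : ∀ x, g x = ∫ y, g (x + y) * p y) (x : E) : g x = g 0 :=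
  le_antisymm (by simpa using harmonic_add_le hp hpi hp1 hg hM hgp x 0)
    (by simpa using harmonic_add_le hp hpi hp1 hg hM hgp (-x) x)

/-- The Choquet-Deny theorem for a strictly positive density: bounded solutions of the convolution
equation `f x = ∫ f (x + y) p y dy` are constant. -/
theorem ae_const_of_ae_harmonic {p : E → ℝ} (hp : ∀ x, 0 < p x) (hpi : Integrable p)
    (hp1 : ∫ x, p x = 1) {f : E → ℂ} (hf : MemLp f ∞ volume)
    (hfp : ∀ᵐ x, f x = ∫ y, f (x + y) * p y) : ∃ c : ℂ, f =ᵐ[volume] fun _ => c := by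
  obtain ⟨M, hM⟩ : ∃ M : ℝ, ∀ᵐ x, ‖f x‖ ≤ M := ⟨_, ae_le_lpNorm_exponent_top hf⟩
  set f' := hf.1.mk f with hf'
  have hff' : f =ᵐ[volume] f' := hf.1.ae_eq_mk
  have hf'm : StronglyMeasurable f' := hf.1.stronglyMeasurable_mk
  have hpm : AEStronglyMeasurable p volume := hpi.aestronglyMeasurable
  have hshift : ∀ {u v : E → ℂ}, u =ᵐ[volume] v → ∀ x : E,
      (fun y => u (x + y)) =ᵐ[volume] fun y => v (x + y) := fun h x =>
    (measurePreserving_add_left volume x).quasiMeasurePreserving.ae_eq_comp h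
  -- `g` is a version of `f` that is measurable, bounded and satisfies the equation at every point.
  set g : E → ℂ := fun x => ∫ y, f (x + y) * p y with hg
  have hgf' : ∀ x, g x = ∫ y, f' (x + y) * (hpm.mk p y : ℝ) := fun x => by
    refine integral_congr_ae ?_
    filter_upwards [hshift hff' x, hpm.ae_eq_mk] with y h1 h2
    rw [h1, h2]
  have hgm : Measurable g := by
    rw [show g = fun x => ∫ y, f' (x + y) * (hpm.mk p y : ℝ) from funext hgf']
    refine (StronglyMeasurable.integral_prod_right ?_).measurable
    refine (hf'm.comp_measurable measurable_add).mul ?_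
    exact (Complex.continuous_ofReal.comp_stronglyMeasurable
      hpm.stronglyMeasurable_mk).comp_measurable measurable_snd
  have hgp : ∀ x, g x = ∫ y, g (x + y) * p y := fun x => by
    refine integral_congr_ae ?_
    filter_upwards [hshift (u := f) (v := g) hfp x] with y h1
    rw [h1]
  have hgM : ∀ x, ‖g x‖ ≤ M := fun x => by
    have h1 : ∀ᵐ y, ‖f (x + y)‖ ≤ M :=
      (measurePreserving_add_left volume x).quasiMeasurePreserving.ae hM
    calc ‖g x‖ ≤ ∫ y, M * p y := by
          refine norm_integral_le_of_norm_le (hpi.const_mul M) ?_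
          filter_upwards [h1] with y hy
          rw [norm_mul, Complex.norm_real, Real.norm_of_nonneg (hp y).le]
          exact mul_le_mul_of_nonneg_right hy (hp y).le
      _ = M := by rw [integral_const_mul, hp1, mul_one]
  have hgi : ∀ x, Integrable (fun y => g (x + y) * p y) := fun x =>
    hpi.ofReal.bdd_mul (hgm.comp (measurable_const_add x)).aestronglyMeasurable
      (ae_of_all _ fun y => hgM (x + y))
  refine ⟨g 0, ?_⟩
  have hfg : f =ᵐ[volume] g := hfp
  refine hfg.trans (ae_of_all _ fun x => Complex.ext ?_ ?_)
  · refine harmonic_eq_apply_zero hp hpi hp1 (Complex.measurable_re.comp hgm) (M := M)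
      (fun x => (Complex.abs_re_le_norm _).trans (hgM x)) (fun x => ?_) x
    have := congrArg Complex.re (hgp x)
    rw [← RCLike.re_eq_complex_re, ← integral_re (hgi x)] at this
    simpa using this
  · refine harmonic_eq_apply_zero hp hpi hp1 (Complex.measurable_im.comp hgm) (M := M)
      (fun x => (Complex.abs_im_le_norm _).trans (hgM x)) (fun x => ?_) x
    have := congrArg Complex.im (hgp x)
    rw [← RCLike.im_eq_complex_im, ← integral_im (hgi x)] at this
    simpa using this

end ChoquetDeny

/-! ### Growth of characteristic exponents -/

section Exponent

lemma norm_one_sub_exp_neg_le {z : ℂ} (hz : 0 ≤ z.re) : ‖1 - Complex.exp (-z)‖ ≤ ‖z‖ := by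
  have hconv : Convex ℝ {w : ℂ | 0 ≤ w.re} := convex_halfSpace_re_ge 0
  have h := hconv.norm_image_sub_le_of_norm_hasDerivWithin_le
    (f := fun w : ℂ => Complex.exp (-w)) (f' := fun w => -Complex.exp (-w)) (C := 1)
    (fun w _ => by
      simpa using ((hasDerivAt_id w).neg.cexp).hasDerivWithinAt)
    (fun w hw => by
      rw [norm_neg, Complex.norm_exp, Complex.neg_re]
      exact Real.exp_le_one_iff.2 (neg_nonpos.2 hw))
    hz (show (0 : ℂ) ∈ {w : ℂ | 0 ≤ w.re} by simp)
  simpa using h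

lemma tendsto_succ_mul_one_sub_exp (z : ℂ) :
    Tendsto (fun k : ℕ => ((k : ℂ) + 1) * (1 - Complex.exp (-(1 / ((k : ℂ) + 1)) * z)))
      atTop (𝓝 z) := by
  have hd : HasDerivAt (fun t : ℝ => 1 - Complex.exp (-(t : ℂ) * z)) z 0 := by
    have h1 : HasDerivAt (fun t : ℝ => -(t : ℂ) * z) (-1 * z) 0 :=
      (Complex.ofRealCLM.hasDerivAt (x := (0 : ℝ))).neg.mul_const z
    simpa using h1.cexp.const_sub 1
  have h2 := hd.tendsto_slope_zero
  have h3 : Tendsto (fun k : ℕ => (1 : ℝ) / ((k : ℝ) + 1)) atTop (𝓝[≠] 0) :=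
    tendsto_nhdsWithin_iff.2 ⟨tendsto_one_div_add_atTop_nhds_zero_nat,
      Eventually.of_forall fun k => by
        simp only [Set.mem_compl_iff, Set.mem_singleton_iff]; positivity⟩
  refine (h2.comp h3).congr fun k => ?_
  simp

variable {E : Type*} [NormedAddCommGroup E] [InnerProductSpace ℝ E] [MeasurableSpace E]
  {μ : ℝ≥0 → Measure E} {ψ : E → ℂ}

/-- The exponent is recovered from the laws at the times `1 / (k + 1)`, as a derivative at time `0`. -/
lemma tendsto_exponent
    (h : ∀ (t : ℝ≥0) (ξ : E), charFun (μ t) ξ = Complex.exp (-((t : ℝ) : ℂ) * ψ ξ)) (ξ : E) :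
    Tendsto (fun k : ℕ => ((k : ℂ) + 1) * (1 - charFun (μ (1 / ((k : ℝ≥0) + 1))) ξ)) atTop
      (𝓝 (ψ ξ)) := by
  refine (tendsto_succ_mul_one_sub_exp (ψ ξ)).congr fun k => ?_
  rw [h]
  simp

lemma norm_exponent_neg
    (h : ∀ (t : ℝ≥0) (ξ : E), charFun (μ t) ξ = Complex.exp (-((t : ℝ) : ℂ) * ψ ξ)) (ξ : E) :
    ‖ψ (-ξ)‖ = ‖ψ ξ‖ := by
  refine tendsto_nhds_unique (tendsto_exponent h (-ξ)).norm
    ((tendsto_exponent h ξ).norm.congr fun k => ?_)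
  rw [charFun_neg, norm_mul, norm_mul, ← Complex.norm_conj (1 - charFun _ ξ), map_sub, map_one]

variable [∀ t, IsProbabilityMeasure (μ t)]

lemma exponent_re_nonneg
    (h : ∀ (t : ℝ≥0) (ξ : E), charFun (μ t) ξ = Complex.exp (-((t : ℝ) : ℂ) * ψ ξ)) (ξ : E) :
    0 ≤ (ψ ξ).re := by
  have h1 := norm_charFun_le_one (μ := μ 1) ξ
  rw [h, Complex.norm_exp] at h1
  simpa using Real.exp_le_one_iff.1 h1

lemma norm_one_sub_charFun_le_mul
    (h : ∀ (t : ℝ≥0) (ξ : E), charFun (μ t) ξ = Complex.exp (-((t : ℝ) : ℂ) * ψ ξ))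
    (t : ℝ≥0) (ξ : E) : ‖1 - charFun (μ t) ξ‖ ≤ t * ‖ψ ξ‖ := by
  rw [h, neg_mul]
  refine (norm_one_sub_exp_neg_le ?_).trans (by simp)
  rw [Complex.re_ofReal_mul]
  exact mul_nonneg t.2 (exponent_re_nonneg h ξ)

variable [FiniteDimensional ℝ E] [BorelSpace E]

lemma integrable_exp_inner (ν : Measure E) [IsProbabilityMeasure ν] (ξ : E) :
    Integrable (fun x => Complex.exp (inner ℝ x ξ * Complex.I)) ν := by
  refine Integrable.of_bound (by fun_prop) 1 (ae_of_all _ fun x => ?_)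
  rw [Complex.norm_exp_ofReal_mul_I]

lemma one_sub_charFun (ν : Measure E) [IsProbabilityMeasure ν] (ξ : E) :
    1 - charFun ν ξ = ∫ x, (1 - Complex.exp (inner ℝ x ξ * Complex.I)) ∂ν := by
  rw [integral_sub (integrable_const _) (integrable_exp_inner ν ξ), charFun_apply]
  simp

lemma integrable_one_sub_exp_inner (ν : Measure E) [IsProbabilityMeasure ν] (ξ : E) :
    Integrable (fun x => 1 - Complex.exp (inner ℝ x ξ * Complex.I)) ν :=
  (integrable_const _).sub (integrable_exp_inner ν ξ)

lemma re_one_sub_charFun (ν : Measure E) [IsProbabilityMeasure ν] (ξ : E) :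
    (1 - charFun ν ξ).re = ∫ x, (1 - Complex.exp (inner ℝ x ξ * Complex.I)).re ∂ν := by
  rw [one_sub_charFun]
  exact (integral_re (integrable_one_sub_exp_inner ν ξ)).symm

lemma im_one_sub_charFun (ν : Measure E) [IsProbabilityMeasure ν] (ξ : E) :
    (1 - charFun ν ξ).im = ∫ x, (1 - Complex.exp (inner ℝ x ξ * Complex.I)).im ∂ν := by
  rw [one_sub_charFun]
  exact (integral_im (integrable_one_sub_exp_inner ν ξ)).symm

lemma norm_one_sub_exp_mul_I_sq (a : ℝ) :
    ‖1 - Complex.exp (a * Complex.I)‖ ^ 2 = 2 * (1 - Complex.exp (a * Complex.I)).re := by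
  rw [← Complex.normSq_eq_norm_sq, Complex.normSq_apply, Complex.sub_re, Complex.sub_im,
    Complex.exp_ofReal_mul_I_re, Complex.exp_ofReal_mul_I_im, Complex.one_re, Complex.one_im]
  nlinarith [Real.sin_sq_add_cos_sq a]

/-- Subadditivity up to a factor `2`. It follows from
`1 - e ^ (i(a+b)) = (1 - e ^ (ia)) + (1 - e ^ (ib)) - (1 - e ^ (ia)) (1 - e ^ (ib))`, the product
being controlled by `‖1 - e ^ (ia)‖² = 2 Re (1 - e ^ (ia))`. -/
lemma norm_one_sub_charFun_add_le (ν : Measure E) [IsProbabilityMeasure ν] (ξ η : E) :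
    ‖1 - charFun ν (ξ + η)‖ ≤ 2 * (‖1 - charFun ν ξ‖ + ‖1 - charFun ν η‖) := by
  have hi := integrable_one_sub_exp_inner ν
  have key : (1 - charFun ν (ξ + η)) - ((1 - charFun ν ξ) + (1 - charFun ν η)) =
      ∫ x, -((1 - Complex.exp (inner ℝ x ξ * Complex.I)) *
        (1 - Complex.exp (inner ℝ x η * Complex.I))) ∂ν := by
    simp only [one_sub_charFun]
    have hadd : Integrable (fun x => (1 - Complex.exp (inner ℝ x ξ * Complex.I)) +
      (1 - Complex.exp (inner ℝ x η * Complex.I))) ν := (hi ξ).add (hi η)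
    rw [← integral_add (hi ξ) (hi η), ← integral_sub (hi _) hadd]
    congr 1 with x
    rw [inner_add_right, Complex.ofReal_add, add_mul, Complex.exp_add]
    ring
  have hb : ‖(1 - charFun ν (ξ + η)) - ((1 - charFun ν ξ) + (1 - charFun ν η))‖ ≤
      (1 - charFun ν ξ).re + (1 - charFun ν η).re := by
    have hir : ∀ ζ : E,
        Integrable (fun x => (1 - Complex.exp (inner ℝ x ζ * Complex.I)).re) ν :=
      fun ζ => (hi ζ).re
    rw [key, re_one_sub_charFun, re_one_sub_charFun, ← integral_add (hir ξ) (hir η)]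
    refine norm_integral_le_of_norm_le ((hir ξ).add (hir η)) (ae_of_all _ fun x => ?_)
    rw [norm_neg, norm_mul]
    have h1 := norm_one_sub_exp_mul_I_sq (inner ℝ x ξ)
    have h2 := norm_one_sub_exp_mul_I_sq (inner ℝ x η)
    have h3 := two_mul_le_add_sq ‖1 - Complex.exp (inner ℝ x ξ * Complex.I)‖
      ‖1 - Complex.exp (inner ℝ x η * Complex.I)‖
    linarith
  have h1 := Complex.re_le_norm (1 - charFun ν ξ)
  have h2 := Complex.re_le_norm (1 - charFun ν η)
  have h3 := norm_sub_norm_le (1 - charFun ν (ξ + η)) ((1 - charFun ν ξ) + (1 - charFun ν η))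
  have h4 := norm_add_le (1 - charFun ν ξ) (1 - charFun ν η)
  linarith

lemma measurable_exponent
    (h : ∀ (t : ℝ≥0) (ξ : E), charFun (μ t) ξ = Complex.exp (-((t : ℝ) : ℂ) * ψ ξ)) :
    Measurable ψ :=
  measurable_of_tendsto_metrizable
    (fun _ => (measurable_const.sub measurable_charFun).const_mul _)
    (tendsto_pi_nhds.2 fun ξ => tendsto_exponent h ξ)

lemma norm_exponent_add_le
    (h : ∀ (t : ℝ≥0) (ξ : E), charFun (μ t) ξ = Complex.exp (-((t : ℝ) : ℂ) * ψ ξ)) (ξ η : E) :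
    ‖ψ (ξ + η)‖ ≤ 2 * (‖ψ ξ‖ + ‖ψ η‖) := by
  refine le_of_tendsto_of_tendsto' (tendsto_exponent h (ξ + η)).norm
    (((tendsto_exponent h ξ).norm.add (tendsto_exponent h η).norm).const_mul 2) fun k => ?_
  have := norm_one_sub_charFun_add_le (μ (1 / ((k : ℝ≥0) + 1))) ξ η
  rw [norm_mul, norm_mul, norm_mul]
  have h0 : 0 ≤ ‖(k : ℂ) + 1‖ := norm_nonneg _
  nlinarith [mul_le_mul_of_nonneg_left this h0]

lemma continuous_charFun_of_isProbabilityMeasure (ν : Measure E) [IsProbabilityMeasure ν] :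
    Continuous (charFun ν) := by
  refine continuous_of_dominated (bound := fun _ => 1) (fun ξ => by fun_prop)
    (fun ξ => ae_of_all _ fun x => ?_) (integrable_const _) (ae_of_all _ fun x => by fun_prop)
  rw [Complex.norm_exp_ofReal_mul_I]

/-- Local boundedness near `0`. The exponent is the limit of a pointwise bounded sequence of
continuous functions, so by Baire's theorem it is bounded on some ball; subadditivity moves that ball
to the origin. -/
lemma exists_ball_norm_exponent_le
    (h : ∀ (t : ℝ≥0) (ξ : E), charFun (μ t) ξ = Complex.exp (-((t : ℝ) : ℂ) * ψ ξ)) :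
    ∃ r > 0, ∃ B : ℝ, ∀ ξ : E, ‖ξ‖ < r → ‖ψ ξ‖ ≤ B := by
  let K : ℕ → Set E := fun N =>
    ⋂ k : ℕ, {ξ | ‖((k : ℂ) + 1) * (1 - charFun (μ (1 / ((k : ℝ≥0) + 1))) ξ)‖ ≤ N}
  have hKc : ∀ N, IsClosed (K N) := fun N => isClosed_iInter fun k =>
    isClosed_le (continuous_const.mul (continuous_const.sub
      (continuous_charFun_of_isProbabilityMeasure _))).norm continuous_const
  have hKU : ⋃ N, K N = Set.univ := by
    refine Set.eq_univ_of_forall fun ξ => ?_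
    obtain ⟨M, hM⟩ := (tendsto_exponent h ξ).norm.bddAbove_range
    obtain ⟨N, hN⟩ := exists_nat_ge M
    exact Set.mem_iUnion.2 ⟨N, Set.mem_iInter.2 fun k => (hM ⟨k, rfl⟩).trans hN⟩
  obtain ⟨N, a, ha⟩ := nonempty_interior_of_iUnion_of_closed hKc hKU
  obtain ⟨r, hr, hball⟩ := Metric.isOpen_iff.1 isOpen_interior a ha
  have hK : ∀ ξ ∈ K N, ‖ψ ξ‖ ≤ N := fun ξ hξ =>
    le_of_tendsto' (tendsto_exponent h ξ).norm fun k => Set.mem_iInter.1 hξ k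
  refine ⟨r, hr, 2 * (N + N), fun ξ hξ => ?_⟩
  have h1 : ‖ψ (ξ + a)‖ ≤ N := hK _ (interior_subset (hball (by simpa using hξ)))
  have h2 : ‖ψ (-a)‖ ≤ N := by
    rw [norm_exponent_neg h]; exact hK _ (interior_subset ha)
  have h3 := norm_exponent_add_le h (ξ + a) (-a)
  rw [add_neg_cancel_right] at h3
  linarith

/-- The exponent grows at most quadratically: by subadditivity, doubling the argument multiplies the
bound by at most `4`. -/
lemma exists_norm_exponent_le
    (h : ∀ (t : ℝ≥0) (ξ : E), charFun (μ t) ξ = Complex.exp (-((t : ℝ) : ℂ) * ψ ξ)) :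
    ∃ C : ℝ, ∀ ξ : E, ‖ψ ξ‖ ≤ C * (1 + ‖ξ‖ ^ 2) := by
  obtain ⟨r, hr, B, hB⟩ := exists_ball_norm_exponent_le h
  have hB0 : 0 ≤ B := (norm_nonneg _).trans (hB 0 (by simpa using hr))
  have hdouble : ∀ (n : ℕ) (ξ : E), ‖ξ‖ < 2 ^ n * r → ‖ψ ξ‖ ≤ 4 ^ n * B := by
    intro n
    induction n with
    | zero => intro ξ hξ; simpa using hB ξ (by simpa using hξ)
    | succ n ih =>
      intro ξ hξ
      have h1 : ‖ψ ((1 / 2 : ℝ) • ξ)‖ ≤ 4 ^ n * B := ih _ (by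
        rw [norm_smul, Real.norm_of_nonneg (by norm_num)]
        rw [pow_succ] at hξ
        linarith)
      have h2 := norm_exponent_add_le h ((1 / 2 : ℝ) • ξ) ((1 / 2 : ℝ) • ξ)
      rw [← add_smul, show (1 / 2 : ℝ) + 1 / 2 = 1 by norm_num, one_smul] at h2
      rw [pow_succ]
      linarith
  refine ⟨B + 4 * B / r ^ 2, fun ξ => ?_⟩
  have hnn : 0 ≤ 4 * B / r ^ 2 := by positivity
  rcases lt_or_ge ‖ξ‖ r with hlt | hge
  · nlinarith [hB ξ hlt, sq_nonneg ‖ξ‖, mul_nonneg hB0 (sq_nonneg ‖ξ‖),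
      mul_nonneg hnn (sq_nonneg ‖ξ‖)]
  · obtain ⟨n, hn1, hn2⟩ := exists_nat_pow_near ((one_le_div hr).2 hge) (one_lt_two (α := ℝ))
    rw [div_lt_iff₀ hr] at hn2
    have h1 := hdouble (n + 1) ξ hn2
    have h2 : (4 : ℝ) ^ n ≤ (‖ξ‖ / r) ^ 2 := by
      calc (4 : ℝ) ^ n = (2 ^ n) ^ 2 := by rw [← pow_mul, mul_comm n 2, pow_mul]; norm_num
        _ ≤ _ := pow_le_pow_left₀ (by positivity) hn1 2
    have h3 : 4 ^ (n + 1) * B ≤ 4 * B / r ^ 2 * ‖ξ‖ ^ 2 := by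
      have := mul_le_mul_of_nonneg_left h2 (show 0 ≤ 4 * B by positivity)
      calc 4 ^ (n + 1) * B = 4 * B * 4 ^ n := by ring
        _ ≤ 4 * B * (‖ξ‖ / r) ^ 2 := this
        _ = _ := by field_simp
    nlinarith [mul_nonneg hB0 (sq_nonneg ‖ξ‖)]

end Exponent

/-! ### Small-time behaviour of the semigroup in `L¹` -/

section SmallTime

variable {ι : Type*}

/-- The coordinatewise sine: a bounded truncation of the identity that agrees with it to second
order at `0`. The coordinates of its expectation are imaginary parts of values of the characteristic
function, which makes it a convenient compensator. -/
noncomputable def sinVec (y : EuclideanSpace ℝ ι) : EuclideanSpace ℝ ι :=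
  WithLp.toLp 2 fun j => Real.sin (y j)

lemma sinVec_apply (y : EuclideanSpace ℝ ι) (j : ι) : sinVec y j = Real.sin (y j) := rfl

lemma continuous_sinVec : Continuous (sinVec (ι := ι)) := by
  unfold sinVec
  fun_prop

variable [Fintype ι]

lemma EuclideanSpace.norm_le_sum_abs (v : EuclideanSpace ℝ ι) : ‖v‖ ≤ ∑ j, |v j| := by
  rw [EuclideanSpace.norm_eq]
  refine Real.sqrt_le_iff.2 ⟨Finset.sum_nonneg fun _ _ => abs_nonneg _, ?_⟩
  simpa using Finset.sum_sq_le_sq_sum_of_nonneg (s := Finset.univ) (f := fun j => |v j|)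
    fun _ _ => abs_nonneg _

lemma norm_sinVec_le (y : EuclideanSpace ℝ ι) : ‖sinVec y‖ ≤ Fintype.card ι := by
  refine (EuclideanSpace.norm_le_sum_abs _).trans ?_
  refine (Finset.sum_le_card_nsmul _ _ 1 fun j _ => Real.abs_sin_le_one _).trans ?_
  simp

lemma norm_sub_sinVec_le {y : EuclideanSpace ℝ ι} (hy : ‖y‖ ≤ 1) :
    ‖y - sinVec y‖ ≤ ‖y‖ ^ 2 := by
  refine (EuclideanSpace.norm_le_sum_abs _).trans ?_
  rw [EuclideanSpace.norm_sq_eq]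
  refine Finset.sum_le_sum fun j _ => ?_
  rw [PiLp.sub_apply, sinVec_apply, Real.norm_eq_abs]
  have h1 : |y j| ≤ 1 := (PiLp.norm_apply_le y j).trans hy
  have h2 := abs_le.1 (Real.sin_bound h1)
  have h0 := abs_nonneg (y j)
  have h3 : |y j| ^ 5 ≤ |y j| ^ 2 := pow_le_pow_of_le_one h0 h1 (by norm_num)
  have h4 : |y j ^ 3| ≤ |y j| ^ 2 := by
    rw [abs_pow]; exact pow_le_pow_of_le_one h0 h1 (by norm_num)
  have h5 := abs_le.1 h4
  exact abs_le.2 ⟨by linarith, by linarith⟩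

/-- The compensator has small mean as soon as the characteristic function is close to `1` at the
standard basis vectors. -/
lemma norm_integral_sinVec_le (ν : Measure (EuclideanSpace ℝ ι)) [IsProbabilityMeasure ν]
    [DecidableEq ι] :
    ‖∫ y, sinVec y ∂ν‖ ≤ ∑ j, ‖1 - charFun ν (EuclideanSpace.single j 1)‖ := by
  have hi : Integrable (fun y => sinVec y) ν :=
    Integrable.of_bound continuous_sinVec.aestronglyMeasurable _ (ae_of_all _ norm_sinVec_le)
  refine (EuclideanSpace.norm_le_sum_abs _).trans (Finset.sum_le_sum fun j _ => ?_)
  have h1 : (∫ y, sinVec y ∂ν) j = ∫ y, Real.sin (y j) ∂ν :=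
    ((EuclideanSpace.proj (𝕜 := ℝ) j).integral_comp_comm hi).symm
  have h2 : ∫ y, Real.sin (y j) ∂ν = -(1 - charFun ν (EuclideanSpace.single j 1)).im := by
    rw [im_one_sub_charFun, ← integral_neg]
    congr 1 with y
    simp [Complex.exp_ofReal_mul_I_im, EuclideanSpace.inner_single_right]
  rw [h1, h2, abs_neg]
  exact Complex.abs_im_le_norm _

/-- The first order Taylor remainder of `φ` at `x` in the direction `-y`, with the increment `y` in
the linear term truncated to the bounded vector `sinVec y`. -/
noncomputable def taylorRemainder (φ : EuclideanSpace ℝ ι → ℂ) (x y : EuclideanSpace ℝ ι) : ℂ :=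
  φ (x - y) - φ x + fderiv ℝ φ x (sinVec y)

variable {φ : EuclideanSpace ℝ ι → ℂ}

lemma exists_norm_taylorRemainder_le (hφ : ContDiff ℝ 2 φ) (hc : HasCompactSupport φ) :
    ∃ C : ℝ, 0 ≤ C ∧ ∀ x y, ‖y‖ ≤ 1 → ‖taylorRemainder φ x y‖ ≤ C * ‖y‖ ^ 2 := by
  have hD : ContDiff ℝ 1 (fderiv ℝ φ) := hφ.fderiv_right (by norm_num)
  have hDc : HasCompactSupport (fderiv ℝ φ) := hc.fderiv ℝ
  obtain ⟨A, hA⟩ := hDc.exists_bound_of_continuous hD.continuous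
  obtain ⟨L, hL⟩ := hD.lipschitzWith_of_hasCompactSupport hDc one_ne_zero
  have hA0 : 0 ≤ A := (norm_nonneg _).trans (hA 0)
  refine ⟨L + A, by positivity, fun x y hy => ?_⟩
  have hdiff : Differentiable ℝ φ := hφ.differentiable (by norm_num)
  have h1 : ‖φ (x - y) - φ x - fderiv ℝ φ x (x - y - x)‖ ≤ L * ‖y‖ * ‖x - y - x‖ := by
    refine (convex_closedBall x ‖y‖).norm_image_sub_le_of_norm_hasFDerivWithin_le'
      (f' := fderiv ℝ φ)
      (fun z _ => (hdiff z).hasFDerivAt.hasFDerivWithinAt) (fun z hz => ?_) (by simp) (by simp)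
    refine (hL.norm_sub_le z x).trans ?_
    rw [mem_closedBall_iff_norm] at hz
    exact mul_le_mul_of_nonneg_left hz L.2
  have e1 : x - y - x = -y := by abel
  rw [e1, norm_neg] at h1
  -- The genuine Taylor remainder, plus the error made by truncating the increment.
  have e2 : taylorRemainder φ x y =
      (φ (x - y) - φ x - fderiv ℝ φ x (-y)) - fderiv ℝ φ x (y - sinVec y) := by
    simp only [taylorRemainder, map_sub, map_neg]
    ring
  rw [e2]
  have h2 : ‖fderiv ℝ φ x (y - sinVec y)‖ ≤ A * ‖y‖ ^ 2 :=
    (ContinuousLinearMap.le_opNorm _ _).trans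
      (mul_le_mul (hA x) (norm_sub_sinVec_le hy) (norm_nonneg _) hA0)
  refine (norm_sub_le _ _).trans ?_
  nlinarith

/-- From `1 - exp (-u) ≥ u / (1 + u)` with `u = a ^ 2 / 2 ≤ 1 / 2`. -/
lemma sq_le_three_mul_one_sub_exp {a : ℝ} (ha : a ^ 2 ≤ 1) :
    a ^ 2 ≤ 3 * (1 - Real.exp (-a ^ 2 / 2)) := by
  have h1 := Real.add_one_le_exp (a ^ 2 / 2)
  have h2 : Real.exp (-a ^ 2 / 2) * Real.exp (a ^ 2 / 2) = 1 := by
    rw [← Real.exp_add, neg_div, neg_add_cancel, Real.exp_zero]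
  have h3 := Real.exp_pos (-a ^ 2 / 2)
  nlinarith [sq_nonneg a, mul_le_mul_of_nonneg_left h1 h3.le]

lemma one_le_three_mul_one_sub_exp {a : ℝ} (ha : 1 ≤ a ^ 2) :
    1 ≤ 3 * (1 - Real.exp (-a ^ 2 / 2)) := by
  have h1 := sq_le_three_mul_one_sub_exp (a := 1) (by norm_num)
  have h2 : Real.exp (-a ^ 2 / 2) ≤ Real.exp (-1 ^ 2 / 2) := Real.exp_le_exp.2 (by linarith)
  linarith

/-- The `L¹` norm of the Taylor remainder is of order `min 1 (‖y‖ ^ 2)`, which is expressed through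
`1 - exp (-‖y‖ ^ 2 / 2)` because the latter has a Gaussian average of `1 - charFun` as its
expectation. -/
lemma exists_lintegral_taylorRemainder_le (hφ : ContDiff ℝ 2 φ) (hc : HasCompactSupport φ) :
    ∃ C : ℝ≥0, ∀ y, ∫⁻ x, ‖taylorRemainder φ x y‖ₑ ≤
      C * ENNReal.ofReal (1 - Real.exp (-‖y‖ ^ 2 / 2)) := by
  obtain ⟨A, hA0, hA⟩ := exists_norm_taylorRemainder_le hφ hc
  have hD : Continuous (fderiv ℝ φ) := hφ.continuous_fderiv (by norm_num)
  have hDi : Integrable (fderiv ℝ φ) volume := hD.integrable_of_hasCompactSupport (hc.fderiv ℝ)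
  have hφi : Integrable φ volume := hφ.continuous.integrable_of_hasCompactSupport hc
  obtain ⟨R, hR⟩ := hc.isCompact.isBounded.subset_closedBall (0 : EuclideanSpace ℝ ι)
  -- For `‖y‖ ≤ 1` the remainder `taylorRemainder φ · y` is supported in this ball.
  set B := Metric.closedBall (0 : EuclideanSpace ℝ ι) (R + 1) with hB
  have hBfin : volume B ≠ ∞ := measure_closedBall_lt_top.ne
  have hzero : ∀ x y, ‖y‖ ≤ 1 → x ∉ B → taylorRemainder φ x y = 0 := by
    intro x y hy hx
    have hx' : R + 1 < ‖x‖ := by simpa [hB] using hx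
    have h1 : ∀ z, R < ‖z‖ → z ∉ tsupport φ := fun z hz hmem => by
      have := hR hmem
      rw [mem_closedBall_zero_iff] at this
      linarith
    have h2 : R < ‖x - y‖ := by
      have := norm_sub_norm_le x y
      linarith
    have h3 : x ∉ tsupport φ := h1 x (by linarith)
    have h4 : fderiv ℝ φ x = 0 :=
      image_eq_zero_of_notMem_tsupport fun h => h3 (tsupport_fderiv_subset ℝ h)
    simp [taylorRemainder, h4, image_eq_zero_of_notMem_tsupport h3,
      image_eq_zero_of_notMem_tsupport (h1 _ h2)]
  set C₁ : ℝ≥0∞ := ENNReal.ofReal A * volume B with hC₁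
  set C₂ : ℝ≥0∞ := (∫⁻ x, ‖φ x‖ₑ) + (∫⁻ x, ‖φ x‖ₑ) +
    (∫⁻ x, ‖fderiv ℝ φ x‖ₑ) * ENNReal.ofReal (Fintype.card ι) with hC₂
  have hC₁fin : C₁ ≠ ∞ := ENNReal.mul_ne_top ENNReal.ofReal_ne_top hBfin
  have hC₂fin : C₂ ≠ ∞ := by
    have h1 : (∫⁻ x, ‖φ x‖ₑ) ≠ ∞ := hφi.2.ne
    have h2 : (∫⁻ x, ‖fderiv ℝ φ x‖ₑ) ≠ ∞ := hDi.2.ne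
    exact ENNReal.add_ne_top.2 ⟨ENNReal.add_ne_top.2 ⟨h1, h1⟩,
      ENNReal.mul_ne_top h2 ENNReal.ofReal_ne_top⟩
  have hsmall : ∀ y, ‖y‖ ≤ 1 →
      ∫⁻ x, ‖taylorRemainder φ x y‖ₑ ≤ C₁ * ENNReal.ofReal (‖y‖ ^ 2) := by
    intro y hy
    calc ∫⁻ x, ‖taylorRemainder φ x y‖ₑ
        ≤ ∫⁻ x, B.indicator (fun _ => ENNReal.ofReal (A * ‖y‖ ^ 2)) x := by
          refine lintegral_mono fun x => ?_
          by_cases hx : x ∈ B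
          · rw [Set.indicator_of_mem hx, ← ofReal_norm]
            exact ENNReal.ofReal_le_ofReal (hA x y hy)
          · simp [hzero x y hy hx]
      _ = C₁ * ENNReal.ofReal (‖y‖ ^ 2) := by
          rw [lintegral_indicator_const measurableSet_closedBall, ENNReal.ofReal_mul hA0, hC₁]
          ring
  have hlarge : ∀ y, ∫⁻ x, ‖taylorRemainder φ x y‖ₑ ≤ C₂ := by
    intro y
    calc ∫⁻ x, ‖taylorRemainder φ x y‖ₑ
        ≤ ∫⁻ x, (‖φ (x - y)‖ₑ + ‖φ x‖ₑ +
            ‖fderiv ℝ φ x‖ₑ * ENNReal.ofReal (Fintype.card ι)) := by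
          refine lintegral_mono fun x => ?_
          refine (enorm_add_le _ _).trans (add_le_add enorm_sub_le ?_)
          refine (ContinuousLinearMap.le_opENorm _ _).trans (mul_le_mul_right ?_ _)
          rw [← ofReal_norm]
          exact ENNReal.ofReal_le_ofReal (norm_sinVec_le y)
      _ = C₂ := by
          have hm : Measurable fun x => ‖φ x‖ₑ := hφ.continuous.enorm.measurable
          have hms : Measurable fun x => ‖φ (x - y)‖ₑ := hm.comp (measurable_sub_const y)
          have hmm : Measurable fun x => ‖φ (x - y)‖ₑ + ‖φ x‖ₑ := hms.add hm
          rw [lintegral_add_left hmm, lintegral_add_left hms,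
            lintegral_mul_const _ hD.enorm.measurable,
            lintegral_sub_right_eq_self (fun x => ‖φ x‖ₑ) y]
  refine ⟨((C₁ + C₂) * 3).toNNReal, fun y => ?_⟩
  have hfin : (C₁ + C₂) * 3 ≠ ∞ :=
    ENNReal.mul_ne_top (ENNReal.add_ne_top.2 ⟨hC₁fin, hC₂fin⟩) (by norm_num)
  rw [ENNReal.coe_toNNReal hfin, mul_assoc, show (3 : ℝ≥0∞) = ENNReal.ofReal 3 by norm_num,
    ← ENNReal.ofReal_mul (by norm_num)]
  rcases le_total ‖y‖ 1 with hy | hy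
  · refine (hsmall y hy).trans (mul_le_mul' le_self_add (ENNReal.ofReal_le_ofReal ?_))
    exact sq_le_three_mul_one_sub_exp (pow_le_one₀ (norm_nonneg _) hy)
  · refine (hlarge y).trans ?_
    calc C₂ ≤ (C₁ + C₂) * 1 := by rw [mul_one]; exact le_add_self
      _ ≤ _ := by
        refine mul_le_mul' le_rfl ?_
        rw [← ENNReal.ofReal_one]
        exact ENNReal.ofReal_le_ofReal (one_le_three_mul_one_sub_exp (one_le_pow₀ hy))

lemma continuous_taylorRemainder (hφ : ContDiff ℝ 2 φ) :
    Continuous fun z : EuclideanSpace ℝ ι × EuclideanSpace ℝ ι => taylorRemainder φ z.1 z.2 := by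
  have hD : Continuous (fderiv ℝ φ) := hφ.continuous_fderiv (by norm_num)
  have h0 := hφ.continuous
  have h1 : Continuous fun z : EuclideanSpace ℝ ι × EuclideanSpace ℝ ι =>
      fderiv ℝ φ z.1 (sinVec z.2) :=
    (hD.comp continuous_fst).clm_apply (continuous_sinVec.comp continuous_snd)
  unfold taylorRemainder
  fun_prop

lemma exists_lintegral_integral_translate_sub_le [DecidableEq ι] (hφ : ContDiff ℝ 2 φ)
    (hc : HasCompactSupport φ) :
    ∃ C : ℝ≥0, ∀ ν : Measure (EuclideanSpace ℝ ι), IsProbabilityMeasure ν →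
      ∫⁻ x, ‖(∫ y, φ (x - y) ∂ν) - φ x‖ₑ ≤ C * ENNReal.ofReal
        ((∫ y, (1 - Real.exp (-‖y‖ ^ 2 / 2)) ∂ν) +
          ∑ j, ‖1 - charFun ν (EuclideanSpace.single j 1)‖) := by
  obtain ⟨C, hC⟩ := exists_lintegral_taylorRemainder_le hφ hc
  have hD : Continuous (fderiv ℝ φ) := hφ.continuous_fderiv (by norm_num)
  have hDi : Integrable (fderiv ℝ φ) volume := hD.integrable_of_hasCompactSupport (hc.fderiv ℝ)
  set D : ℝ≥0 := (∫⁻ x, ‖fderiv ℝ φ x‖ₑ).toNNReal with hDdef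
  have hDeq : (D : ℝ≥0∞) = ∫⁻ x, ‖fderiv ℝ φ x‖ₑ := ENNReal.coe_toNNReal hDi.2.ne
  obtain ⟨b, hb⟩ := hc.exists_bound_of_continuous hφ.continuous
  refine ⟨C + D, fun ν _ => ?_⟩
  have hexp : ∀ y : EuclideanSpace ℝ ι, Real.exp (-‖y‖ ^ 2 / 2) ≤ 1 := fun y =>
    Real.exp_le_one_iff.2 (by have := sq_nonneg ‖y‖; linarith)
  have hsi : Integrable (fun y => sinVec y) ν :=
    Integrable.of_bound continuous_sinVec.aestronglyMeasurable _ (ae_of_all _ norm_sinVec_le)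
  have hφi : ∀ x, Integrable (fun y => φ (x - y)) ν := fun x =>
    Integrable.of_bound (hφ.continuous.comp (by fun_prop)).aestronglyMeasurable b
      (ae_of_all _ fun y => hb _)
  have hei : Integrable (fun y : EuclideanSpace ℝ ι => 1 - Real.exp (-‖y‖ ^ 2 / 2)) ν := by
    refine Integrable.of_bound (by fun_prop) 1 (ae_of_all _ fun y => ?_)
    have := hexp y
    rw [Real.norm_of_nonneg (by linarith)]
    linarith [Real.exp_pos (-‖y‖ ^ 2 / 2)]
  have hrm := continuous_taylorRemainder hφ
  have hsplit : ∀ x, (∫ y, φ (x - y) ∂ν) - φ x =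
      (∫ y, taylorRemainder φ x y ∂ν) - fderiv ℝ φ x (∫ y, sinVec y ∂ν) := by
    intro x
    have i1 : Integrable (fun y => φ (x - y) - φ x) ν := (hφi x).sub (integrable_const _)
    have i2 : Integrable (fun y => fderiv ℝ φ x (sinVec y)) ν :=
      (fderiv ℝ φ x).integrable_comp hsi
    simp only [taylorRemainder]
    rw [integral_add i1 i2, integral_sub (hφi x) (integrable_const _),
      (fderiv ℝ φ x).integral_comp_comm hsi]
    simp
  calc ∫⁻ x, ‖(∫ y, φ (x - y) ∂ν) - φ x‖ₑ
      ≤ ∫⁻ x, ((∫⁻ y, ‖taylorRemainder φ x y‖ₑ ∂ν) +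
          ‖fderiv ℝ φ x‖ₑ * ‖∫ y, sinVec y ∂ν‖ₑ) := by
        refine lintegral_mono fun x => ?_
        rw [hsplit]
        exact enorm_sub_le.trans (add_le_add (enorm_integral_le_lintegral_enorm _)
          (ContinuousLinearMap.le_opENorm _ _))
    _ = (∫⁻ y, ∫⁻ x, ‖taylorRemainder φ x y‖ₑ ∂volume ∂ν) + D * ‖∫ y, sinVec y ∂ν‖ₑ := by
        rw [lintegral_add_right _ (hD.enorm.measurable.mul_const _),
          lintegral_mul_const _ hD.enorm.measurable, hDeq]
        congr 1
        exact lintegral_lintegral_swap hrm.enorm.measurable.aemeasurable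
    _ ≤ C * ENNReal.ofReal (∫ y, (1 - Real.exp (-‖y‖ ^ 2 / 2)) ∂ν) +
          D * ENNReal.ofReal (∑ j, ‖1 - charFun ν (EuclideanSpace.single j 1)‖) := by
        refine add_le_add ?_ (mul_le_mul' le_rfl ?_)
        · rw [ofReal_integral_eq_lintegral_ofReal hei
            (ae_of_all _ fun y => sub_nonneg.2 (hexp y)), ← lintegral_const_mul']
          · exact lintegral_mono hC
          · exact ENNReal.coe_ne_top
        · rw [← ofReal_norm]
          exact ENNReal.ofReal_le_ofReal (norm_integral_sinVec_le ν)
    _ ≤ _ := by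
        rw [ENNReal.coe_add, add_mul]
        refine add_le_add (mul_le_mul' le_rfl (ENNReal.ofReal_le_ofReal ?_))
          (mul_le_mul' le_rfl (ENNReal.ofReal_le_ofReal ?_))
        · exact le_add_of_nonneg_right (Finset.sum_nonneg fun _ _ => norm_nonneg _)
        · exact le_add_of_nonneg_left (integral_nonneg fun y => sub_nonneg.2 (hexp y))

section Gaussian

variable {E : Type*} [NormedAddCommGroup E] [InnerProductSpace ℝ E] [FiniteDimensional ℝ E]
  [MeasurableSpace E] [BorelSpace E]

/-- Fubini's theorem for `1 - exp (i ⟨y, ξ⟩)` under `ν ⊗ stdGaussian`, the standard Gaussian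
being the probability measure with characteristic function `exp (-‖y‖ ^ 2 / 2)`. -/
lemma integral_one_sub_exp_neg_sq_eq (ν : Measure E) [IsProbabilityMeasure ν] :
    ∫ y, (1 - Real.exp (-‖y‖ ^ 2 / 2)) ∂ν = ∫ ξ, (1 - charFun ν ξ).re ∂(stdGaussian E) := by
  have h1 : ∀ y : E, 1 - Real.exp (-‖y‖ ^ 2 / 2) =
      ∫ ξ, (1 - Complex.exp (inner ℝ y ξ * Complex.I)).re ∂(stdGaussian E) := by
    intro y
    have h2 := re_one_sub_charFun (stdGaussian E) y
    rw [charFun_stdGaussian,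
      show (-(‖y‖ : ℂ) ^ 2 / 2) = ((-‖y‖ ^ 2 / 2 : ℝ) : ℂ) by push_cast; ring,
      Complex.sub_re, Complex.exp_ofReal_re, Complex.one_re] at h2
    simpa only [real_inner_comm y] using h2
  simp only [h1, re_one_sub_charFun]
  refine integral_integral_swap (Integrable.of_bound ?_ 2 (ae_of_all _ fun z => ?_))
  · exact Continuous.aestronglyMeasurable (by fun_prop)
  · refine (Complex.abs_re_le_norm _).trans ((norm_sub_le _ _).trans ?_)
    rw [Complex.norm_exp_ofReal_mul_I]
    norm_num

variable {μ : ℝ≥0 → Measure E} [∀ t, IsProbabilityMeasure (μ t)] {ψ : E → ℂ}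

lemma exists_integral_one_sub_exp_neg_sq_le
    (h : ∀ (t : ℝ≥0) (ξ : E), charFun (μ t) ξ = Complex.exp (-((t : ℝ) : ℂ) * ψ ξ)) :
    ∃ C : ℝ, ∀ t, ∫ y, (1 - Real.exp (-‖y‖ ^ 2 / 2)) ∂(μ t) ≤ t * C := by
  obtain ⟨C, hC⟩ := exists_norm_exponent_le h
  have hsq : Integrable (fun ξ : E => ‖ξ‖ ^ 2) (stdGaussian E) :=
    (IsGaussian.memLp_two_id (μ := stdGaussian E)).integrable_norm_pow two_ne_zero
  have hψi : Integrable (fun ξ => ‖ψ ξ‖) (stdGaussian E) := by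
    refine Integrable.mono' (((integrable_const 1).add hsq).const_mul C)
      (measurable_exponent h).norm.aestronglyMeasurable (ae_of_all _ fun ξ => ?_)
    simpa using hC ξ
  refine ⟨∫ ξ, ‖ψ ξ‖ ∂(stdGaussian E), fun t => ?_⟩
  rw [integral_one_sub_exp_neg_sq_eq, ← integral_const_mul]
  refine integral_mono ?_ (hψi.const_mul _) fun ξ =>
    (Complex.re_le_norm _).trans (norm_one_sub_charFun_le_mul h t ξ)
  refine Integrable.of_bound ?_ 2 (ae_of_all _ fun ξ =>
    (Complex.abs_re_le_norm _).trans norm_one_sub_charFun_le_two)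
  exact (Complex.measurable_re.comp
    (measurable_const.sub measurable_charFun)).aestronglyMeasurable

end Gaussian

/-- The semigroup moves a test function by `O(t)` in `L¹`. -/
lemma exists_lintegral_semigroup_sub_le {μ : ℝ≥0 → Measure (EuclideanSpace ℝ ι)}
    [∀ t, IsProbabilityMeasure (μ t)] {ψ : EuclideanSpace ℝ ι → ℂ}
    (h : ∀ t ξ, charFun (μ t) ξ = Complex.exp (-((t : ℝ) : ℂ) * ψ ξ))
    (hφ : ContDiff ℝ 2 φ) (hc : HasCompactSupport φ) :
    ∃ C : ℝ≥0, ∀ t : ℝ≥0, ∫⁻ x, ‖(∫ y, φ (x - y) ∂(μ t)) - φ x‖ₑ ≤ t * C := by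
  classical
  obtain ⟨C, hC⟩ := exists_lintegral_integral_translate_sub_le hφ hc
  obtain ⟨C', hC'⟩ := exists_integral_one_sub_exp_neg_sq_le h
  refine ⟨C * (C' + ∑ j, ‖ψ (EuclideanSpace.single j 1)‖).toNNReal, fun t => ?_⟩
  refine (hC (μ t) inferInstance).trans ?_
  calc _ ≤ (C : ℝ≥0∞) * ENNReal.ofReal (t * (C' + ∑ j, ‖ψ (EuclideanSpace.single j 1)‖)) := by
        refine mul_le_mul' le_rfl (ENNReal.ofReal_le_ofReal ?_)
        rw [mul_add, Finset.mul_sum]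
        exact add_le_add (hC' t) (Finset.sum_le_sum fun j _ => norm_one_sub_charFun_le_mul h t _)
    _ = _ := by
        rw [ENNReal.ofReal_mul (NNReal.coe_nonneg t), ENNReal.ofReal_coe_nnreal, ENNReal.coe_mul, ENNReal.ofReal]
        ring

end SmallTime

/-! ### Convolution semigroups and generators as Fourier multipliers -/

section FourierMultiplier

variable {V : Type*} [NormedAddCommGroup V] [InnerProductSpace ℝ V] [FiniteDimensional ℝ V]
  [MeasurableSpace V] [BorelSpace V]

lemma fourierInv_apply_eq_integral_cexp (h : V → ℂ) (x : V) :
    𝓕⁻ h x = ∫ ξ, Complex.exp (((2 * Real.pi * inner ℝ ξ x : ℝ) : ℂ) * Complex.I) * h ξ := by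
  rw [Real.fourierInv_eq']
  simp only [smul_eq_mul]

lemma norm_cexp_ofReal_mul_I_mul (a : ℝ) (z : ℂ) : ‖Complex.exp (a * Complex.I) * z‖ = ‖z‖ := by
  rw [norm_mul, Complex.norm_exp_ofReal_mul_I, one_mul]

lemma integrable_cexp_mul {h : V → ℂ} (hh : Integrable h) (x : V) :
    Integrable (fun ξ => Complex.exp (((2 * Real.pi * inner ℝ ξ x : ℝ) : ℂ) * Complex.I) * h ξ) :=
  hh.bdd_mul (c := 1) (by fun_prop) (ae_of_all _ fun ξ => by rw [Complex.norm_exp_ofReal_mul_I])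

lemma continuous_fourierInv_of_integrable {h : V → ℂ} (hh : Integrable h) :
    Continuous (𝓕⁻ h) := by
  rw [show 𝓕⁻ h = _ from funext (fourierInv_apply_eq_integral_cexp h)]
  refine continuous_of_dominated (bound := fun ξ => ‖h ξ‖)
    (fun x => (integrable_cexp_mul hh x).aestronglyMeasurable)
    (fun x => ae_of_all _ fun ξ => (norm_cexp_ofReal_mul_I_mul _ _).le) hh.norm
    (ae_of_all _ fun ξ => by fun_prop)

/-- Averaging over the translates `x - y` multiplies the Fourier transform by the conjugate of the
characteristic function. -/
lemma integral_fourierInv_sub {h : V → ℂ} (hh : Integrable h) (ν : Measure V)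
    [IsProbabilityMeasure ν] (x : V) :
    ∫ y, 𝓕⁻ h (x - y) ∂ν =
      𝓕⁻ (fun ξ => (starRingEnd ℂ) (charFun ν ((2 * Real.pi) • ξ)) * h ξ) x := by
  simp only [fourierInv_apply_eq_integral_cexp]
  rw [integral_integral_swap]
  · congr 1 with ξ
    rw [← charFun_neg, charFun_apply, ← mul_assoc, integral_mul_const, ← integral_const_mul]
    congr 1
    refine integral_congr_ae (ae_of_all _ fun y => ?_)
    simp only
    rw [← Complex.exp_add, inner_sub_right, inner_neg_right, inner_smul_right, real_inner_comm y]
    congr 1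
    push_cast
    ring
  · have h1 : Integrable (fun z : V × V => h z.2) (ν.prod volume) := hh.comp_snd ν
    refine h1.bdd_mul (c := 1) ?_ (ae_of_all _ fun z => ?_)
    · exact Continuous.aestronglyMeasurable (by fun_prop)
    · rw [Complex.norm_exp_ofReal_mul_I]

/-- The operator commutes with translations; `ψ` is arbitrary. -/
lemma levyGenerator_compSub {n : ℕ} (ψ : EuclideanSpace ℝ (Fin n) → ℂ)
    (φ : 𝓢(EuclideanSpace ℝ (Fin n), ℂ)) (a x : EuclideanSpace ℝ (Fin n)) :
    levyGenerator ψ (φ.compSubConstCLM ℂ a) x = levyGenerator ψ φ (x - a) := by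
  have h1 : ∀ ξ, 𝓕 (φ.compSubConstCLM ℂ a : EuclideanSpace ℝ (Fin n) → ℂ) ξ =
      Complex.exp (((-(2 * Real.pi * inner ℝ ξ a) : ℝ) : ℂ) * Complex.I) *
        𝓕 (φ : EuclideanSpace ℝ (Fin n) → ℂ) ξ := by
    intro ξ
    rw [Real.fourier_eq', Real.fourier_eq', ← integral_const_mul,
      ← integral_add_right_eq_self _ a]
    congr 1 with v
    simp only [SchwartzMap.compSubConstCLM_apply, add_sub_cancel_right, smul_eq_mul]
    rw [← mul_assoc, ← Complex.exp_add, inner_add_left, real_inner_comm a]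
    congr 2
    push_cast
    ring
  unfold levyGenerator
  rw [fourierInv_apply_eq_integral_cexp, fourierInv_apply_eq_integral_cexp]
  congr 1 with ξ
  rw [h1, inner_sub_right]
  rw [show ((2 * Real.pi * (inner ℝ ξ x - inner ℝ ξ a) : ℝ) : ℂ) * Complex.I =
    ((2 * Real.pi * inner ℝ ξ x : ℝ) : ℂ) * Complex.I +
      ((-(2 * Real.pi * inner ℝ ξ a) : ℝ) : ℂ) * Complex.I by push_cast; ring, Complex.exp_add]
  ring

lemma fourierInv_fourier_apply (φ : 𝓢(V, ℂ)) (x : V) :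
    𝓕⁻ (𝓕 (φ : V → ℂ)) x = φ x := by
  rw [φ.continuous.fourierInv_fourier_eq φ.integrable (𝓕 φ).integrable]

lemma integrable_symbol_mul_fourier {q : V → ℂ} (hq : Measurable q) {C : ℝ}
    (hC : ∀ ξ, ‖q ξ‖ ≤ C * (1 + ‖ξ‖ ^ 2)) (φ : 𝓢(V, ℂ)) :
    Integrable (fun ξ => q ξ * 𝓕 (φ : V → ℂ) ξ) := by
  have h0 : Integrable (fun ξ => ‖(𝓕 φ) ξ‖) := (𝓕 φ).integrable.norm
  have h2 : Integrable (fun ξ => ‖ξ‖ ^ 2 * ‖(𝓕 φ) ξ‖) := (𝓕 φ).integrable_pow_mul volume 2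
  refine ((h0.add h2).const_mul C).mono'
    (hq.aestronglyMeasurable.mul (𝓕 φ).continuous.aestronglyMeasurable) (ae_of_all _ fun ξ => ?_)
  rw [norm_mul]
  have := mul_le_mul_of_nonneg_right (hC ξ) (norm_nonneg ((𝓕 φ) ξ))
  simp only [Pi.add_apply]
  rw [SchwartzMap.fourier_coe] at *
  linarith

lemma norm_exp_neg_mul_le_one {q : ℂ} (hq : 0 ≤ q.re) {s : ℝ} (hs : 0 ≤ s) :
    ‖Complex.exp (-(s : ℂ) * q)‖ ≤ 1 := by
  rw [Complex.norm_exp, ← Complex.ofReal_neg, Complex.re_ofReal_mul]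
  exact Real.exp_le_one_iff.2 (by nlinarith)

lemma integrable_exp_neg_mul {q h : V → ℂ} (hq : Measurable q) (hre : ∀ ξ, 0 ≤ (q ξ).re)
    (hh : Integrable h) {s : ℝ} (hs : 0 ≤ s) :
    Integrable (fun ξ => Complex.exp (-(s : ℂ) * q ξ) * h ξ) :=
  hh.bdd_mul (c := 1) (by fun_prop) (ae_of_all _ fun ξ => norm_exp_neg_mul_le_one (hre ξ) hs)

lemma tendsto_fourierInv_difference_quotient {q h : V → ℂ} (hq : Measurable q)
    (hre : ∀ ξ, 0 ≤ (q ξ).re) (hh : Integrable h) (hqh : Integrable fun ξ => q ξ * h ξ) (x : V) :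
    Tendsto (fun k : ℕ => ((k : ℂ) + 1) *
      (𝓕⁻ (fun ξ => Complex.exp (-((1 / ((k : ℝ) + 1) : ℝ) : ℂ) * q ξ) * h ξ) x - 𝓕⁻ h x)) atTop
      (𝓝 (𝓕⁻ (fun ξ => -q ξ * h ξ) x)) := by
  have e : ∀ k : ℕ, ((k : ℂ) + 1) *
      (𝓕⁻ (fun ξ => Complex.exp (-((1 / ((k : ℝ) + 1) : ℝ) : ℂ) * q ξ) * h ξ) x - 𝓕⁻ h x) =
      ∫ ξ, Complex.exp (((2 * Real.pi * inner ℝ ξ x : ℝ) : ℂ) * Complex.I) *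
        (-(((k : ℂ) + 1) * (1 - Complex.exp (-(1 / ((k : ℂ) + 1)) * q ξ))) * h ξ) := by
    intro k
    have hs : (0 : ℝ) ≤ 1 / ((k : ℝ) + 1) := by positivity
    rw [fourierInv_apply_eq_integral_cexp, fourierInv_apply_eq_integral_cexp,
      ← integral_sub (integrable_cexp_mul (integrable_exp_neg_mul hq hre hh hs) x)
        (integrable_cexp_mul hh x), ← integral_const_mul]
    congr 1 with ξ
    push_cast
    ring
  simp only [e]
  rw [fourierInv_apply_eq_integral_cexp]
  refine tendsto_integral_of_dominated_convergence (fun ξ => ‖q ξ * h ξ‖) (fun k => ?_)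
    hqh.norm (fun k => ae_of_all _ fun ξ => ?_) (ae_of_all _ fun ξ => ?_)
  · refine AEStronglyMeasurable.mul (by fun_prop) (AEStronglyMeasurable.mul ?_ hh.1)
    exact Measurable.aestronglyMeasurable (by fun_prop)
  · rw [norm_cexp_ofReal_mul_I_mul, norm_mul, norm_mul, norm_neg, norm_mul]
    refine mul_le_mul_of_nonneg_right ?_ (norm_nonneg _)
    have hk : (0 : ℝ) < (k : ℝ) + 1 := by positivity
    have hkc : ‖(k : ℂ) + 1‖ = (k : ℝ) + 1 := by
      rw [show (k : ℂ) + 1 = (((k : ℝ) + 1 : ℝ) : ℂ) by push_cast; ring, Complex.norm_real,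
        Real.norm_of_nonneg hk.le]
    have h1 : ‖1 - Complex.exp (-((1 / ((k : ℂ) + 1)) * q ξ))‖ ≤ ‖1 / ((k : ℂ) + 1) * q ξ‖ := by
      refine norm_one_sub_exp_neg_le ?_
      rw [show 1 / ((k : ℂ) + 1) = ((1 / ((k : ℝ) + 1) : ℝ) : ℂ) by push_cast; ring,
        Complex.re_ofReal_mul]
      exact mul_nonneg (by positivity) (hre ξ)
    rw [norm_mul, norm_div, norm_one, hkc] at h1
    rw [neg_mul, hkc]
    calc _ ≤ ((k : ℝ) + 1) * (1 / ((k : ℝ) + 1) * ‖q ξ‖) := mul_le_mul_of_nonneg_left h1 hk.le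
      _ = ‖q ξ‖ := by field_simp
  · exact ((tendsto_succ_mul_one_sub_exp (q ξ)).neg.mul_const _).const_mul _

/-- The integrated form of the semigroup equation `d/dt T_t = T_t L`, on the Fourier side. -/
lemma fourierInv_exp_sub_eq_integral {q h : V → ℂ} (hq : Measurable q)
    (hre : ∀ ξ, 0 ≤ (q ξ).re) (hh : Integrable h) (hqh : Integrable fun ξ => q ξ * h ξ)
    {t : ℝ} (ht : 0 ≤ t) (x : V) :
    𝓕⁻ (fun ξ => Complex.exp (-(t : ℂ) * q ξ) * h ξ) x - 𝓕⁻ h x =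
      ∫ s in Set.Ioc 0 t, 𝓕⁻ (fun ξ => Complex.exp (-(s : ℂ) * q ξ) * (-q ξ * h ξ)) x := by
  simp only [fourierInv_apply_eq_integral_cexp]
  rw [← integral_sub (integrable_cexp_mul (integrable_exp_neg_mul hq hre hh ht) x)
        (integrable_cexp_mul hh x), integral_integral_swap]
  · congr 1 with ξ
    have hd : ∀ s ∈ Set.uIcc 0 t, HasDerivAt (fun s : ℝ => Complex.exp (-(s : ℂ) * q ξ))
        (Complex.exp (-(s : ℂ) * q ξ) * -q ξ) s := by
      intro s _
      have h1 : HasDerivAt (fun s : ℝ => -(s : ℂ) * q ξ) (-1 * q ξ) s :=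
        (Complex.ofRealCLM.hasDerivAt (x := s)).neg.mul_const (q ξ)
      simpa using h1.cexp
    have hi := intervalIntegral.integral_eq_sub_of_hasDerivAt hd
      (Continuous.intervalIntegrable (by fun_prop) _ _)
    rw [intervalIntegral.integral_of_le ht] at hi
    simp only [← mul_assoc]
    rw [integral_mul_const]
    simp only [mul_assoc]
    rw [integral_const_mul, hi]
    simp
    ring
  · have h1 : Integrable (fun z : ℝ × V => q z.2 * h z.2)
        ((volume.restrict (Set.Ioc 0 t)).prod volume) := hqh.comp_snd _
    refine h1.mono ?_ ?_
    · refine AEStronglyMeasurable.mul (by fun_prop) (AEStronglyMeasurable.mul ?_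
        (AEStronglyMeasurable.mul ?_ hh.1.comp_snd))
      · exact Measurable.aestronglyMeasurable (by fun_prop)
      · exact Measurable.aestronglyMeasurable (by fun_prop)
    · have h2 : ∀ᵐ z : ℝ × V ∂((volume.restrict (Set.Ioc 0 t)).prod volume), z.1 ∈ Set.Ioc 0 t :=
        Measure.quasiMeasurePreserving_fst.ae (ae_restrict_mem measurableSet_Ioc)
      filter_upwards [h2] with z hz
      simp only [Function.uncurry]
      rw [norm_cexp_ofReal_mul_I_mul, norm_mul, neg_mul (q z.2), norm_neg]
      exact mul_le_of_le_one_left (norm_nonneg _) (norm_exp_neg_mul_le_one (hre _) hz.1.le)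

lemma aestronglyMeasurable_fourierInv_exp {q h : V → ℂ} (hq : Measurable q)
    (hh : Integrable h) {m : Measure (ℝ × V)} :
    AEStronglyMeasurable
      (fun z : ℝ × V => 𝓕⁻ (fun ξ => Complex.exp (-(z.1 : ℂ) * q ξ) * h ξ) z.2) m := by
  have e : (fun z : ℝ × V => 𝓕⁻ (fun ξ => Complex.exp (-(z.1 : ℂ) * q ξ) * h ξ) z.2) =
      fun z => ∫ ξ, Complex.exp (((2 * Real.pi * inner ℝ ξ z.2 : ℝ) : ℂ) * Complex.I) *
        (Complex.exp (-(z.1 : ℂ) * q ξ) * hh.1.mk h ξ) := by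
    funext z
    rw [fourierInv_apply_eq_integral_cexp]
    refine integral_congr_ae ?_
    filter_upwards [hh.1.ae_eq_mk] with ξ hξ
    rw [hξ]
  rw [e]
  have hm : Measurable (hh.1.mk h) := hh.1.stronglyMeasurable_mk.measurable
  refine StronglyMeasurable.aestronglyMeasurable
    (StronglyMeasurable.integral_prod_right (Measurable.stronglyMeasurable ?_))
  simp only [Function.uncurry_def]
  fun_prop

end FourierMultiplier

/-! ### Weak solutions are invariant under the semigroup -/

section Liouville

lemma integrable_prod_comp_sub {E : Type*} [NormedAddCommGroup E] [InnerProductSpace ℝ E]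
    [FiniteDimensional ℝ E] [MeasurableSpace E] [BorelSpace E] {L : E → ℂ}
    (hL : Integrable L) (hLc : Continuous L) (ν : Measure E) [IsProbabilityMeasure ν] :
    Integrable (fun z : E × E => L (z.1 - z.2)) (volume.prod ν) := by
  have hc : Continuous fun z : E × E => L (z.1 - z.2) := hLc.comp (by fun_prop)
  refine (integrable_prod_iff' hc.aestronglyMeasurable).2
    ⟨ae_of_all _ fun y => hL.comp_sub_right y, ?_⟩
  have : ∀ y, ∫ x, ‖L (x - y)‖ = ∫ x, ‖L x‖ := fun y =>
    integral_sub_right_eq_self (fun x => ‖L x‖) y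
  simp only [this]
  exact integrable_const _

variable {n : ℕ} {μ : ℝ≥0 → Measure (EuclideanSpace ℝ (Fin n))} [∀ t, IsProbabilityMeasure (μ t)]
  {ψ : EuclideanSpace ℝ (Fin n) → ℂ}

/-- The symbol, with respect to Mathlib's Fourier transform, of the adjoint semigroup
`φ ↦ ∫ φ (· - y) dμ_t(y)`: this semigroup multiplies `𝓕 φ` by `exp (-t * adjointSymbol ψ)`. The
factor `2 π` comes from the kernel `exp (-2 π i y · ξ)`. -/
noncomputable def adjointSymbol (ψ : EuclideanSpace ℝ (Fin n) → ℂ)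
    (ξ : EuclideanSpace ℝ (Fin n)) : ℂ :=
  (starRingEnd ℂ) (ψ ((2 * Real.pi) • ξ))

lemma levyGenerator_conj_eq (ψ : EuclideanSpace ℝ (Fin n) → ℂ)
    (φ : 𝓢(EuclideanSpace ℝ (Fin n), ℂ)) :
    levyGenerator (fun ξ => (starRingEnd ℂ) (ψ ξ)) φ =
      𝓕⁻ (fun ξ => -adjointSymbol ψ ξ * 𝓕 (φ : EuclideanSpace ℝ (Fin n) → ℂ) ξ) := rfl

lemma measurable_adjointSymbol
    (h : ∀ t ξ, charFun (μ t) ξ = Complex.exp (-((t : ℝ) : ℂ) * ψ ξ)) :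
    Measurable (adjointSymbol ψ) := by
  have := measurable_exponent h
  unfold adjointSymbol
  exact Complex.continuous_conj.measurable.comp (this.comp (measurable_const_smul _))

lemma adjointSymbol_re_nonneg
    (h : ∀ t ξ, charFun (μ t) ξ = Complex.exp (-((t : ℝ) : ℂ) * ψ ξ))
    (ξ : EuclideanSpace ℝ (Fin n)) : 0 ≤ (adjointSymbol ψ ξ).re := by
  simpa [adjointSymbol] using exponent_re_nonneg h _

lemma integrable_adjointSymbol_mul
    (h : ∀ t ξ, charFun (μ t) ξ = Complex.exp (-((t : ℝ) : ℂ) * ψ ξ))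
    (φ : 𝓢(EuclideanSpace ℝ (Fin n), ℂ)) :
    Integrable
      (fun ξ => adjointSymbol ψ ξ * 𝓕 (φ : EuclideanSpace ℝ (Fin n) → ℂ) ξ) := by
  obtain ⟨C, hC⟩ := exists_norm_exponent_le h
  have hC0 : 0 ≤ C := by simpa using (norm_nonneg _).trans (hC 0)
  refine integrable_symbol_mul_fourier (measurable_adjointSymbol h)
    (C := C * (1 + (2 * Real.pi) ^ 2)) (fun ξ => ?_) φ
  have h1 := hC ((2 * Real.pi) • ξ)
  rw [norm_smul, Real.norm_of_nonneg (by positivity)] at h1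
  rw [adjointSymbol, RCLike.norm_conj]
  refine h1.trans ?_
  rw [mul_assoc C]
  refine mul_le_mul_of_nonneg_left ?_ hC0
  nlinarith [sq_nonneg ‖ξ‖, sq_nonneg (2 * Real.pi)]

lemma integral_fourierInv_sub_law
    (h : ∀ t ξ, charFun (μ t) ξ = Complex.exp (-((t : ℝ) : ℂ) * ψ ξ))
    {k : EuclideanSpace ℝ (Fin n) → ℂ} (hk : Integrable k) (t : ℝ≥0)
    (x : EuclideanSpace ℝ (Fin n)) :
    ∫ y, 𝓕⁻ k (x - y) ∂(μ t) =
      𝓕⁻ (fun ξ => Complex.exp (-((t : ℝ) : ℂ) * adjointSymbol ψ ξ) * k ξ) x := by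
  rw [integral_fourierInv_sub hk]
  refine congrArg (fun u : EuclideanSpace ℝ (Fin n) → ℂ => 𝓕⁻ u x) (funext fun ξ => ?_)
  rw [h, ← Complex.exp_conj, adjointSymbol]
  simp

lemma integral_schwartz_sub_law
    (h : ∀ t ξ, charFun (μ t) ξ = Complex.exp (-((t : ℝ) : ℂ) * ψ ξ))
    (φ : 𝓢(EuclideanSpace ℝ (Fin n), ℂ)) (t : ℝ≥0) (x : EuclideanSpace ℝ (Fin n)) :
    ∫ y, φ (x - y) ∂(μ t) =
      𝓕⁻ (fun ξ => Complex.exp (-((t : ℝ) : ℂ) * adjointSymbol ψ ξ) *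
        𝓕 (φ : EuclideanSpace ℝ (Fin n) → ℂ) ξ) x := by
  rw [← integral_fourierInv_sub_law h (𝓕 φ).integrable]
  simp only [fourierInv_fourier_apply]

lemma continuous_levyGenerator_conj
    (h : ∀ t ξ, charFun (μ t) ξ = Complex.exp (-((t : ℝ) : ℂ) * ψ ξ))
    (φ : 𝓢(EuclideanSpace ℝ (Fin n), ℂ)) :
    Continuous (levyGenerator (fun ξ => (starRingEnd ℂ) (ψ ξ)) φ) := by
  rw [levyGenerator_conj_eq]
  refine continuous_fourierInv_of_integrable ?_
  simpa only [neg_mul] using! (integrable_adjointSymbol_mul h φ).neg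

/-- The adjoint generator maps test functions to `L¹`, so the integral that defines
`levyGeneratorPairing` converges for bounded `f`. The difference quotients of the semigroup converge
to it pointwise and are bounded in `L¹`, and Fatou's lemma applies. -/
theorem integrable_levyGenerator_conj
    (h : ∀ t ξ, charFun (μ t) ξ = Complex.exp (-((t : ℝ) : ℂ) * ψ ξ))
    (φ : 𝓢(EuclideanSpace ℝ (Fin n), ℂ)) (hφ : HasCompactSupport φ) :
    Integrable (levyGenerator (fun ξ => (starRingEnd ℂ) (ψ ξ)) φ) := by
  refine ⟨(continuous_levyGenerator_conj h φ).aestronglyMeasurable, ?_⟩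
  obtain ⟨C, hC⟩ := exists_lintegral_semigroup_sub_le h (φ.smooth 2) hφ
  let τ : ℕ → ℝ≥0 := fun k => 1 / ((k : ℝ≥0) + 1)
  let F : ℕ → EuclideanSpace ℝ (Fin n) → ℂ := fun k x =>
    ((k : ℂ) + 1) * ((∫ y, φ (x - y) ∂(μ (τ k))) - φ x)
  have hF : ∀ x, Tendsto (fun k => ‖F k x‖ₑ) atTop
      (𝓝 ‖levyGenerator (fun ξ => (starRingEnd ℂ) (ψ ξ)) φ x‖ₑ) := by
    intro x
    have := tendsto_fourierInv_difference_quotient (measurable_adjointSymbol h)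
      (adjointSymbol_re_nonneg h) (𝓕 φ).integrable (integrable_adjointSymbol_mul h φ) x
    refine (this.congr fun k => ?_).enorm
    simp only [F, τ]
    rw [integral_schwartz_sub_law h, fourierInv_fourier_apply]
    push_cast
    rfl
  have hφc := φ.continuous
  obtain ⟨b, hb⟩ := hφ.exists_bound_of_continuous hφc
  have hFm : ∀ k, Continuous (F k) := fun k => by
    refine continuous_const.mul (Continuous.sub ?_ hφc)
    exact continuous_of_dominated (bound := fun _ => b)
      (fun x => (hφc.comp (by fun_prop)).aestronglyMeasurable)
      (fun x => ae_of_all _ fun y => hb _) (integrable_const _)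
      (ae_of_all _ fun y => hφc.comp (by fun_prop))
  have hbound : ∀ k, ∫⁻ x, ‖F k x‖ₑ ≤ C := by
    intro k
    have hk : ‖(k : ℂ) + 1‖ₑ = ((k + 1 : ℝ≥0) : ℝ≥0∞) := by
      rw [show (k : ℂ) + 1 = ((k + 1 : ℕ) : ℂ) by push_cast; ring, ← ofReal_norm,
        Complex.norm_natCast, ENNReal.ofReal_natCast]
      push_cast
      rfl
    simp only [F, enorm_mul]
    rw [lintegral_const_mul' _ _ enorm_ne_top]
    refine (mul_le_mul' le_rfl (hC (τ k))).trans (le_of_eq ?_)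
    rw [hk, ← mul_assoc, ← ENNReal.coe_mul]
    simp only [τ]
    rw [mul_one_div_cancel (by positivity), ENNReal.coe_one, one_mul]
  calc ∫⁻ x, ‖levyGenerator (fun ξ => (starRingEnd ℂ) (ψ ξ)) φ x‖ₑ
      = ∫⁻ x, liminf (fun k => ‖F k x‖ₑ) atTop :=
        lintegral_congr fun x => (hF x).liminf_eq.symm
    _ ≤ liminf (fun k => ∫⁻ x, ‖F k x‖ₑ) atTop :=
        lintegral_liminf_le fun k => (hFm k).enorm.measurable
    _ ≤ C := liminf_le_of_le (by isBoundedDefault) fun b hb => by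
        obtain ⟨k, hk⟩ := hb.exists
        exact hk.trans (hbound k)
    _ < ∞ := ENNReal.coe_lt_top

/-- A bounded weak solution is orthogonal to `T_t φ - φ`, where `T_t φ x = ∫ φ (x - y) dμ_t(y)`.
Indeed `T_t φ - φ = ∫₀ᵗ T_s L φ ds`, and `T_s L φ` is an average of translates of `L φ`, each of which
is `L` applied to a translate of `φ`, again a compactly supported test function. -/
theorem integral_mul_semigroup_sub_eq_zero
    (h : ∀ t ξ, charFun (μ t) ξ = Complex.exp (-((t : ℝ) : ℂ) * ψ ξ))
    {f : EuclideanSpace ℝ (Fin n) → ℂ} (hf : MemLp f ∞ volume)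
    (hzero : ∀ φ : 𝓢(EuclideanSpace ℝ (Fin n), ℂ), HasCompactSupport φ →
      levyGeneratorPairing ψ f φ = 0)
    (φ : 𝓢(EuclideanSpace ℝ (Fin n), ℂ)) (hφ : HasCompactSupport φ) (t : ℝ≥0) :
    ∫ x, f x * ((∫ y, φ (x - y) ∂(μ t)) - φ x) = 0 := by
  set L := levyGenerator (fun ξ => (starRingEnd ℂ) (ψ ξ)) φ with hL
  have hLi : Integrable L := integrable_levyGenerator_conj h φ hφ
  have hLc : Continuous L := continuous_levyGenerator_conj h φ
  have hqi := integrable_adjointSymbol_mul h φ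
  have hqi' : Integrable
      (fun ξ => -adjointSymbol ψ ξ * 𝓕 (φ : EuclideanSpace ℝ (Fin n) → ℂ) ξ) := by
    simpa only [neg_mul] using! hqi.neg
  obtain ⟨M, hM⟩ : ∃ M : ℝ, ∀ᵐ x, ‖f x‖ ≤ M := ⟨_, ae_le_lpNorm_exponent_top hf⟩
  -- `G s = T_s L φ`, written on the Fourier side so that joint measurability in `(s, x)` is visible.
  let G : ℝ → EuclideanSpace ℝ (Fin n) → ℂ := fun s x =>
    𝓕⁻ (fun ξ => Complex.exp (-(s : ℂ) * adjointSymbol ψ ξ) *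
      (-adjointSymbol ψ ξ * 𝓕 (φ : EuclideanSpace ℝ (Fin n) → ℂ) ξ)) x
  have hG : ∀ s : ℝ, 0 ≤ s → ∀ x, G s x = ∫ y, L (x - y) ∂(μ s.toNNReal) := by
    intro s hs x
    rw [hL, levyGenerator_conj_eq, integral_fourierInv_sub_law h hqi', Real.coe_toNNReal s hs]
  have hprod : ∀ s : ℝ, Integrable
      (fun z : EuclideanSpace ℝ (Fin n) × EuclideanSpace ℝ (Fin n) => L (z.1 - z.2))
      (volume.prod (μ s.toNNReal)) := fun s => integrable_prod_comp_sub hLi hLc _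
  have hGi : ∀ s : ℝ, 0 ≤ s → Integrable (G s) := fun s hs =>
    (hprod s).integral_prod_left.congr (ae_of_all _ fun x => (hG s hs x).symm)
  have hGn : ∀ s : ℝ, 0 ≤ s → ∫ x, ‖G s x‖ ≤ ∫ x, ‖L x‖ := by
    intro s hs
    calc ∫ x, ‖G s x‖ ≤ ∫ x, ∫ y, ‖L (x - y)‖ ∂(μ s.toNNReal) := by
          refine integral_mono (hGi s hs).norm (hprod s).norm.integral_prod_left fun x => ?_
          simp only [hG s hs x]
          exact norm_integral_le_integral_norm _
      _ = ∫ y, ∫ x, ‖L (x - y)‖ ∂volume ∂(μ s.toNNReal) :=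
          integral_integral_swap (hprod s).norm
      _ = ∫ x, ‖L x‖ := by
          have : ∀ y, ∫ x, ‖L (x - y)‖ = ∫ x, ‖L x‖ := fun y =>
            integral_sub_right_eq_self (fun x => ‖L x‖) y
          simp [this]
  have hGz : ∀ s : ℝ, 0 ≤ s → ∫ x, f x * G s x = 0 := by
    intro s hs
    have hfi : Integrable
        (fun z : EuclideanSpace ℝ (Fin n) × EuclideanSpace ℝ (Fin n) => f z.1 * L (z.1 - z.2))
        (volume.prod (μ s.toNNReal)) :=
      (hprod s).bdd_mul (c := M) hf.1.comp_fst (Measure.quasiMeasurePreserving_fst.ae hM)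
    calc ∫ x, f x * G s x = ∫ x, ∫ y, f x * L (x - y) ∂(μ s.toNNReal) := by
          simp only [hG s hs, integral_const_mul]
      _ = ∫ y, ∫ x, f x * L (x - y) ∂volume ∂(μ s.toNNReal) := integral_integral_swap hfi
      _ = 0 := by
          -- The equation for `f`, tested against the translate `φ (· - y)`.
          have : ∀ y, ∫ x, f x * L (x - y) = 0 := fun y => by
            have h1 := hzero (φ.compSubConstCLM ℂ y) (by
              simpa [Function.comp_def, sub_eq_add_neg] using!
                hφ.comp_homeomorph (Homeomorph.addRight (-y)))
            simpa only [levyGeneratorPairing, levyGenerator_compSub] using h1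
          simp [this]
  have hGprod : Integrable (fun z : ℝ × EuclideanSpace ℝ (Fin n) => f z.2 * G z.1 z.2)
      ((volume.restrict (Set.Ioc 0 (t : ℝ))).prod volume) := by
    have hGm : AEStronglyMeasurable (fun z : ℝ × EuclideanSpace ℝ (Fin n) => G z.1 z.2)
        ((volume.restrict (Set.Ioc 0 (t : ℝ))).prod volume) :=
      aestronglyMeasurable_fourierInv_exp (measurable_adjointSymbol h) hqi'
    have h1 : Integrable (fun z : ℝ × EuclideanSpace ℝ (Fin n) => G z.1 z.2)
        ((volume.restrict (Set.Ioc 0 (t : ℝ))).prod volume) := by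
      refine (integrable_prod_iff hGm).2 ⟨?_, ?_⟩
      · filter_upwards [ae_restrict_mem measurableSet_Ioc] with s hs
        exact hGi s hs.1.le
      · refine Integrable.of_bound hGm.norm.integral_prod_right' (∫ x, ‖L x‖) ?_
        filter_upwards [ae_restrict_mem measurableSet_Ioc] with s hs
        rw [Real.norm_of_nonneg (integral_nonneg fun _ => norm_nonneg _)]
        exact hGn s hs.1.le
    exact h1.bdd_mul (c := M) hf.1.comp_snd (Measure.quasiMeasurePreserving_snd.ae hM)
  calc ∫ x, f x * ((∫ y, φ (x - y) ∂(μ t)) - φ x)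
      = ∫ x, ∫ s in Set.Ioc 0 (t : ℝ), f x * G s x := by
        congr 1 with x
        have h1 := fourierInv_exp_sub_eq_integral (measurable_adjointSymbol h)
          (adjointSymbol_re_nonneg h) (𝓕 φ).integrable hqi t.2 x
        rw [fourierInv_fourier_apply] at h1
        rw [integral_const_mul, integral_schwartz_sub_law h]
        exact congrArg (f x * ·) h1
    _ = ∫ s in Set.Ioc 0 (t : ℝ), ∫ x, f x * G s x := (integral_integral_swap hGprod).symm
    _ = 0 := by
        refine (setIntegral_congr_fun measurableSet_Ioc fun s hs => hGz s hs.1.le).trans ?_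
        simp

/-- The duality between averaging over `x - y` and over `x + y` turns orthogonality to all `T_t φ - φ`
into the convolution equation for `f`. -/
theorem ae_eq_integral_translate
    (h : ∀ t ξ, charFun (μ t) ξ = Complex.exp (-((t : ℝ) : ℂ) * ψ ξ))
    {f : EuclideanSpace ℝ (Fin n) → ℂ} (hf : MemLp f ∞ volume)
    (hzero : ∀ φ : 𝓢(EuclideanSpace ℝ (Fin n), ℂ), HasCompactSupport φ →
      levyGeneratorPairing ψ f φ = 0) (t : ℝ≥0) {p : EuclideanSpace ℝ (Fin n) → ℝ}
    (hp : Measurable p) (hp0 : ∀ x, 0 ≤ p x) (hpi : Integrable p)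
    (hdens : μ t = volume.withDensity (fun x => ENNReal.ofReal (p x))) :
    ∀ᵐ x, f x = ∫ y, f (x + y) * p y := by
  obtain ⟨M, hM⟩ : ∃ M : ℝ, ∀ᵐ x, ‖f x‖ ≤ M := ⟨_, ae_le_lpNorm_exponent_top hf⟩
  have hint : ∀ u : EuclideanSpace ℝ (Fin n) → ℂ, ∫ y, u y ∂(μ t) = ∫ y, u y * p y := by
    intro u
    rw [hdens, integral_withDensity_eq_integral_toReal_smul (by fun_prop)
      (ae_of_all _ fun _ => ENNReal.ofReal_lt_top)]
    congr 1 with y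
    rw [ENNReal.toReal_ofReal (hp0 y), Complex.real_smul, mul_comm]
  set g : EuclideanSpace ℝ (Fin n) → ℂ := fun x => ∫ y, f (x + y) * p y with hg
  have hadd := quasiMeasurePreserving_add (volume : Measure (EuclideanSpace ℝ (Fin n)))
    (volume : Measure (EuclideanSpace ℝ (Fin n)))
  have hfshift : AEStronglyMeasurable
      (fun z : EuclideanSpace ℝ (Fin n) × EuclideanSpace ℝ (Fin n) => f (z.1 + z.2))
      (volume.prod volume) :=
    hf.1.comp_quasiMeasurePreserving hadd
  have hgm : AEStronglyMeasurable g volume := by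
    refine AEStronglyMeasurable.integral_prod_right'
      (f := fun z : EuclideanSpace ℝ (Fin n) × EuclideanSpace ℝ (Fin n) =>
        f (z.1 + z.2) * p z.2) (hfshift.mul ?_)
    exact Measurable.aestronglyMeasurable (by fun_prop)
  have hgM : ∀ x, ‖g x‖ ≤ ∫ y, M * p y := fun x => by
    have h1 : ∀ᵐ y, ‖f (x + y)‖ ≤ M :=
      (measurePreserving_add_left volume x).quasiMeasurePreserving.ae hM
    refine norm_integral_le_of_norm_le (hpi.const_mul M) ?_
    filter_upwards [h1] with y hy
    rw [norm_mul, Complex.norm_real, Real.norm_of_nonneg (hp0 y)]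
    exact mul_le_mul_of_nonneg_right hy (hp0 y)
  have hgL : MemLp g ∞ volume := memLp_top_of_bound hgm _ (ae_of_all _ hgM)
  suffices hae : ∀ᵐ x, g x - f x = 0 by
    filter_upwards [hae] with x hx
    exact (sub_eq_zero.1 hx).symm
  refine ae_eq_zero_of_integral_contDiff_smul_eq_zero
    ((hgL.sub hf).locallyIntegrable le_top) fun θ hθ hθc => ?_
  have hφc : HasCompactSupport fun x => (θ x : ℂ) := hθc.comp_left Complex.ofReal_zero
  set φ : 𝓢(EuclideanSpace ℝ (Fin n), ℂ) :=
    hφc.toSchwartzMap (Complex.ofRealCLM.contDiff.comp hθ) with hφ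
  have hφx : ∀ x, φ x = (θ x : ℂ) := fun x => rfl
  have hmain := integral_mul_semigroup_sub_eq_zero h hf hzero φ hφc t
  have hfφ : ∀ u : EuclideanSpace ℝ (Fin n) → ℂ, MemLp u ∞ volume →
      Integrable (fun x => u x * φ x) := fun u hu =>
    φ.integrable.bdd_mul hu.1 (ae_le_lpNorm_exponent_top hu)
  have hprod₁ : Integrable
      (fun z : EuclideanSpace ℝ (Fin n) × EuclideanSpace ℝ (Fin n) => f z.1 * φ (z.1 - z.2))
      (volume.prod (μ t)) :=
    (integrable_prod_comp_sub φ.integrable φ.continuous (μ t)).bdd_mul (c := M) hf.1.comp_fst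
      (Measure.quasiMeasurePreserving_fst.ae hM)
  have hprod₂ : Integrable
      (fun z : EuclideanSpace ℝ (Fin n) × EuclideanSpace ℝ (Fin n) =>
        f (z.1 + z.2) * (φ z.1 * p z.2)) (volume.prod volume) :=
    (φ.integrable.mul_prod hpi.ofReal).bdd_mul (c := M) hfshift (hadd.ae hM)
  have hT : Integrable (fun x => f x * ∫ y, φ (x - y) ∂(μ t)) := by
    have := hprod₁.integral_prod_left
    simpa only [integral_const_mul] using this
  -- Fubini and the substitution `x ↦ x + y`.
  have hswap : ∫ x, f x * ∫ y, φ (x - y) ∂(μ t) = ∫ x, g x * φ x := by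
    calc ∫ x, f x * ∫ y, φ (x - y) ∂(μ t)
        = ∫ x, ∫ y, f x * φ (x - y) ∂(μ t) := by simp only [integral_const_mul]
      _ = ∫ y, ∫ x, f x * φ (x - y) ∂volume ∂(μ t) := integral_integral_swap hprod₁
      _ = ∫ y, ∫ x, f (x + y) * (φ x * p y) := by
          rw [hint]
          congr 1 with y
          rw [← integral_mul_const, ← integral_add_right_eq_self _ y]
          simp only [add_sub_cancel_right, mul_assoc]
      _ = ∫ x, ∫ y, f (x + y) * (φ x * p y) := (integral_integral_swap hprod₂).symm
      _ = ∫ x, g x * φ x := by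
          congr 1 with x
          rw [hg, ← integral_mul_const]
          congr 1 with y
          ring
  simp only [mul_sub] at hmain
  rw [integral_sub hT (hfφ f hf), hswap, ← integral_sub (hfφ g hgL) (hfφ f hf)] at hmain
  rw [← hmain]
  congr 1 with x
  rw [Complex.real_smul, hφx]
  ring

end Liouville

theorem corollary3 {n : ℕ} {Ω : Type*} [MeasurableSpace Ω] (P : Measure Ω)
    [IsProbabilityMeasure P] (X : ℝ≥0 → Ω → EuclideanSpace ℝ (Fin n))
    (hX : IsLevyProcess X P) (ψ : EuclideanSpace ℝ (Fin n) → ℂ) (hψ : HasCharExponent X P ψ)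
    (t₀ : ℝ≥0) (ht₀ : 0 < t₀) (p : EuclideanSpace ℝ (Fin n) → ℝ) (hp : Measurable p)
    (hp_pos : ∀ x, 0 < p x)
    (hdens : transitionLaw X P t₀ = volume.withDensity (fun x => ENNReal.ofReal (p x))) :
    HasLiouvilleProperty ψ := by
  have hprob : ∀ t, IsProbabilityMeasure (transitionLaw X P t) := fun t =>
    Measure.isProbabilityMeasure_map (hX.measurable t).aemeasurable
  intro f hf hzero
  have hmass : ∫⁻ x, ENNReal.ofReal (p x) = 1 := by
    have h1 := (hprob t₀).measure_univ
    rwa [hdens, withDensity_apply _ MeasurableSet.univ, setLIntegral_univ] at h1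
  have hp0 : ∀ᵐ x, 0 ≤ p x := ae_of_all _ fun x => (hp_pos x).le
  have hpi : Integrable p := by
    refine ⟨hp.aestronglyMeasurable, ?_⟩
    rw [hasFiniteIntegral_iff_ofReal hp0, hmass]
    exact ENNReal.one_lt_top
  have hp1 : ∫ x, p x = 1 := by
    rw [integral_eq_lintegral_of_nonneg_ae hp0 hp.aestronglyMeasurable, hmass, ENNReal.toReal_one]
  exact ae_const_of_ae_harmonic hp_pos hpi hp1 hf
    (ae_eq_integral_translate hψ hf hzero t₀ hp (fun x => (hp_pos x).le) hpi hdens)
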